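/- Let $F$ be R. Thompson's group: the group of all orientation-preserving piecewise-linear homeomorphisms of $[0,1]$ with finitely many breaks in slope, all breaks lying over dyadic rationals $\mathbb{Z}[1/2]$, and all slopes integral powers of $2$. Let $\phi:F\to\mathbb{Z}^2$ be the homomorphism $\phi(f)=(\log_2 f'(0),\log_2 f'(1))$, where $f'(0)$ and $f'(1)$ are one-sided derivatives. For positive integers $a,b$ let $\tilde K_{(a,b)}=\langle (a,0),(0,b)\rangle\le\mathbb{Z}^2$ and $K_{(a,b)}=\phi^{-1}(\tilde K_{(a,b)})\le F$; the groups $K_{(a,b)}$ are called the rectangular subgroups of $F$. For a finite index subgroup $H$ of $F$, let $\operatorname{Inner}(H)$ denote the maximal rectangular subgroup of $H$, that is, the rectangular group contained in $H$ which contains every rectangular group contained in $H$. (1) The map $H\mapsto\phi(H)$ is a bijection from the set of finite index subgroups of $F$ onto the set of finite index subgroups of $\mathbb{Z}^2$. (2) Let $H$ be a finite index subgroup of $F$ and put $\tilde H=\phi(H)\le\mathbb{Z}^2$. There are positive integers $a,b$ such that $\operatorname{Inner}(H)=K_{(a,b)}$, and such that $a\le c$ and $b\le d$ for all positive integers $c,d$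 with $K_{(c,d)}\le H$. Moreover, whenever $a,b$ are positive integers with $\operatorname{Inner}(H)=K_{(a,b)}$, then $\tilde K_{(a,b)}\le\tilde H$, the quotient $Q=\tilde H/\tilde K_{(a,b)}$ is finite cyclic, $K_{(a,b)}\cong F$, and there are homomorphisms $\iota:K_{(a,b)}\to H$, $\rho:H\to Q$, $\tilde\iota:\tilde K_{(a,b)}\to\tilde H$ and $\tilde\rho:\tilde H\to Q$, with $\iota$ and $\tilde\iota$ the inclusions and $\tilde\rho$ the quotient map, such that the rows $$1\to K_{(a,b)}\xrightarrow{\ \iota\ }H\xrightarrow{\ \rho\ }Q\to 1,\qquad 1\to\tilde K_{(a,b)}\xrightarrow{\ \tilde\iota\ }\tilde H\xrightarrow{\ \tilde\rho\ }Q\to 1$$ are exact and form a commutative diagram: $\phi|_H\circ\iota=\tilde\iota\circ\phi|_{K_{(a,b)}}$ and $\rho=\tilde\rho\circ\phi|_H$. -/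

import Mathlib

open Set

namespace Thompson

/-- Dyadic rationals: the real numbers in `ℤ[1/2]`. -/
def IsDyadic (x : ℝ) : Prop := ∃ (m : ℤ) (n : ℕ), x = (m : ℝ) / 2 ^ n

/-- `f` is piecewise linear with finitely many breaks, all of them dyadic rationals, and with all
slopes integral powers of two: there is a finite set `B` of dyadic rationals such that on every
subinterval `[u, v]` of `[0, 1]` with no point of `B` in its interior, `f` is affine with slope
`2 ^ n` for an integer `n`. -/
def IsDyadicPL (f : unitInterval → unitInterval) : Prop :=
  ∃ B : Finset unitInterval, (∀ b ∈ B, IsDyadic (b : ℝ)) ∧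
    ∀ u v : unitInterval, u < v → (∀ b ∈ B, ¬ (u < b ∧ b < v)) →
      ∃ n : ℤ, ∀ x ∈ Icc u v, (f x : ℝ) = (f u : ℝ) + (2 : ℝ) ^ n * ((x : ℝ) - (u : ℝ))

theorem IsDyadic.zero : IsDyadic 0 := ⟨0, 0, by simp⟩

theorem IsDyadic.add {x y : ℝ} (hx : IsDyadic x) (hy : IsDyadic y) : IsDyadic (x + y) := by
  obtain ⟨m, n, rfl⟩ := hx
  obtain ⟨m', n', rfl⟩ := hy
  refine ⟨m * 2 ^ n' + m' * 2 ^ n, n + n', ?_⟩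
  push_cast
  rw [pow_add]
  field_simp

theorem IsDyadic.neg {x : ℝ} (hx : IsDyadic x) : IsDyadic (-x) := by
  obtain ⟨m, n, rfl⟩ := hx
  exact ⟨-m, n, by push_cast; ring⟩

theorem IsDyadic.zpow_mul {x : ℝ} (hx : IsDyadic x) (k : ℤ) : IsDyadic ((2 : ℝ) ^ k * x) := by
  obtain ⟨m, n, rfl⟩ := hx
  obtain ⟨j, rfl | rfl⟩ := k.eq_nat_or_neg
  · exact ⟨2 ^ j * m, n, by push_cast; rw [zpow_natCast]; ring⟩
  · refine ⟨m, n + j, ?_⟩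
    rw [zpow_neg, zpow_natCast, pow_add]
    field_simp

theorem map_zero_of_strictMono {f : unitInterval ≃ₜ unitInterval} (hf : StrictMono f) :
    f 0 = 0 := by
  obtain ⟨x, hx⟩ := f.surjective 0
  exact le_antisymm ((hf.monotone (unitInterval.nonneg' (t := x))).trans_eq hx) unitInterval.nonneg'

theorem map_one_of_strictMono {f : unitInterval ≃ₜ unitInterval} (hf : StrictMono f) :
    f 1 = 1 := by
  obtain ⟨x, hx⟩ := f.surjective 1
  exact le_antisymm unitInterval.le_one'
    (hx.symm.trans_le (hf.monotone (unitInterval.le_one' (t := x))))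

theorem strictMono_symm {f : unitInterval ≃ₜ unitInterval} (hf : StrictMono f) :
    StrictMono f.symm := by
  intro x y h
  rw [← hf.lt_iff_lt]
  simpa using h

/-- To the left of each point `x > 0` there is a largest point that is `0` or a break. -/
theorem exists_left_break (B : Finset unitInterval) (x : unitInterval) (hx : 0 < x) :
    ∃ u, u < x ∧ (u = 0 ∨ u ∈ B) ∧ ∀ b ∈ B, ¬ (u < b ∧ b < x) := by
  classical
  let S := insert 0 (B.filter (· < x))
  have hS : S.Nonempty := ⟨0, by simp [S]⟩
  have hm := S.max'_mem hS
  refine ⟨S.max' hS, ?_, ?_, ?_⟩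
  · rcases Finset.mem_insert.1 hm with h | h
    · rw [h]; exact hx
    · exact (Finset.mem_filter.1 h).2
  · rcases Finset.mem_insert.1 hm with h | h
    · exact Or.inl h
    · exact Or.inr (Finset.mem_filter.1 h).1
  · rintro b hb ⟨h1, h2⟩
    exact absurd (S.le_max' b (by simp [S, hb, h2])) (not_le.2 h1)

theorem exists_right_break (B : Finset unitInterval) (x : unitInterval) (hx : x < 1) :
    ∃ v, x < v ∧ (v = 1 ∨ v ∈ B) ∧ ∀ b ∈ B, ¬ (x < b ∧ b < v) := by
  classical
  let S := insert 1 (B.filter (x < ·))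
  have hS : S.Nonempty := ⟨1, by simp [S]⟩
  have hm := S.min'_mem hS
  refine ⟨S.min' hS, ?_, ?_, ?_⟩
  · rcases Finset.mem_insert.1 hm with h | h
    · rw [h]; exact hx
    · exact (Finset.mem_filter.1 h).2
  · rcases Finset.mem_insert.1 hm with h | h
    · exact Or.inl h
    · exact Or.inr (Finset.mem_filter.1 h).1
  · rintro b hb ⟨h1, h2⟩
    exact absurd (S.min'_le b (by simp [S, hb, h1])) (not_le.2 h2)

theorem isDyadic_map_iff {f : unitInterval ≃ₜ unitInterval} (hf : StrictMono f)
    (hpl : IsDyadicPL f) (x : unitInterval) : IsDyadic (f x : ℝ) ↔ IsDyadic (x : ℝ) := by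
  classical
  obtain ⟨B, hB, h⟩ := hpl
  induction x using WellFounded.induction
    (measure (fun x : unitInterval => (B.filter (· < x)).card)).wf with
  | _ x ih =>
    rcases (unitInterval.nonneg' (t := x)).eq_or_lt with rfl | hx
    · rw [map_zero_of_strictMono hf]
    obtain ⟨u, hux, hu, hub⟩ := exists_left_break B x hx
    have hud : IsDyadic (u : ℝ) := by
      rcases hu with rfl | hu
      · simpa using IsDyadic.zero
      · exact hB u hu
    have hfu : IsDyadic (f u : ℝ) := by
      by_cases h0 : u = 0
      · subst h0
        rw [map_zero_of_strictMono hf]; simpa using IsDyadic.zero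
      · have huB : u ∈ B := hu.resolve_left h0
        refine (ih u ?_).2 hud
        refine Finset.card_lt_card ?_
        refine Finset.ssubset_iff_of_subset ?_ |>.2 ⟨u, by simp [huB, hux], by simp⟩
        intro b hb
        simp only [Finset.mem_filter] at hb ⊢
        exact ⟨hb.1, hb.2.trans hux⟩
    obtain ⟨n, hn⟩ := h u x hux hub
    have e := hn x ⟨hux.le, le_rfl⟩
    constructor
    · intro hd
      have e' : (x : ℝ) = u + (2 : ℝ) ^ (-n) * ((f x : ℝ) + -(f u : ℝ)) := by
        rw [e, zpow_neg]; field_simp; ring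
      rw [e']
      exact hud.add ((hd.add hfu.neg).zpow_mul _)
    · intro hd
      rw [e]
      exact hfu.add ((hd.add hud.neg).zpow_mul n)

end Thompson

open Thompson in
/-- R. Thompson's group `F`: the orientation-preserving homeomorphisms of the unit interval that
are piecewise linear with finitely many breaks, all at dyadic rationals, and with slopes integral
powers of two. The group law is composition. -/
def thompsonF : Subgroup (unitInterval ≃ₜ unitInterval) where
  carrier := {f | StrictMono f ∧ IsDyadicPL f}
  one_mem' := ⟨fun _ _ h => h, ∅, by simp, fun u v _ _ => ⟨0, fun x _ => by simp⟩⟩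
  mul_mem' := by
    classical
    rintro f g ⟨hf, hfp⟩ ⟨hg, hgp⟩
    refine ⟨hf.comp hg, ?_⟩
    obtain ⟨B, hB, h⟩ := hfp
    obtain ⟨C, hC, k⟩ := id hgp
    refine ⟨C ∪ B.image g.symm, ?_, ?_⟩
    · intro b hb
      rcases Finset.mem_union.1 hb with hb | hb
      · exact hC b hb
      · obtain ⟨c, hc, rfl⟩ := Finset.mem_image.1 hb
        rw [← isDyadic_map_iff hg hgp]
        simpa using hB c hc
    · intro u v huv hno
      obtain ⟨n, hn⟩ := k u v huv fun b hb => hno b (Finset.mem_union_left _ hb)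
      obtain ⟨m, hm⟩ := h (g u) (g v) (hg huv) (by
        rintro b hb ⟨h1, h2⟩
        refine hno (g.symm b) (Finset.mem_union_right _ (Finset.mem_image_of_mem _ hb)) ⟨?_, ?_⟩
        · rw [← hg.lt_iff_lt]; simpa using h1
        · rw [← hg.lt_iff_lt]; simpa using h2)
      refine ⟨m + n, fun x hx => ?_⟩
      have e := hm (g x) ⟨hg.monotone hx.1, hg.monotone hx.2⟩
      rw [hn x hx] at e
      change (f (g x) : ℝ) = (f (g u) : ℝ) + _
      rw [e, zpow_add₀ two_ne_zero]
      ring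
  inv_mem' := by
    classical
    rintro f ⟨hf, hfp⟩
    refine ⟨strictMono_symm hf, ?_⟩
    obtain ⟨B, hB, h⟩ := id hfp
    refine ⟨B.image f, ?_, ?_⟩
    · intro b hb
      obtain ⟨c, hc, rfl⟩ := Finset.mem_image.1 hb
      exact (isDyadic_map_iff hf hfp c).2 (hB c hc)
    · intro u v huv hno
      obtain ⟨n, hn⟩ := h (f.symm u) (f.symm v) (strictMono_symm hf huv) (by
        rintro b hb ⟨h1, h2⟩
        refine hno (f b) (Finset.mem_image_of_mem _ hb) ⟨?_, ?_⟩
        · simpa using hf h1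
        · simpa using hf h2)
      refine ⟨-n, fun x hx => ?_⟩
      have e := hn (f.symm x) ⟨(strictMono_symm hf).monotone hx.1,
        (strictMono_symm hf).monotone hx.2⟩
      simp only [Homeomorph.apply_symm_apply] at e
      change (f.symm x : ℝ) = (f.symm u : ℝ) + _
      rw [e, zpow_neg]
      field_simp
      ring

namespace Thompson

/-- An element of `F`, regarded as a real function (constant outside `[0, 1]`). -/
noncomputable def toReal (f : thompsonF) (x : ℝ) : ℝ :=
  ((f : unitInterval ≃ₜ unitInterval) (projIcc 0 1 zero_le_one x) : ℝ)

/-- `f'(0)`, the derivative from the right at `0`. -/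
noncomputable def slopeZero (f : thompsonF) : ℝ := derivWithin (toReal f) (Icc 0 1) 0

/-- `f'(1)`, the derivative from the left at `1`. -/
noncomputable def slopeOne (f : thompsonF) : ℝ := derivWithin (toReal f) (Icc 0 1) 1

theorem germ_zero (f : thompsonF) : ∃ n : ℤ, ∃ v : unitInterval, 0 < v ∧
    ∀ x ∈ Icc 0 v, ((f : unitInterval ≃ₜ unitInterval) x : ℝ) = (2 : ℝ) ^ n * (x : ℝ) := by
  obtain ⟨f, hf, B, hB, h⟩ := f
  obtain ⟨v, hv, -, hvb⟩ := exists_right_break B 0 zero_lt_one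
  obtain ⟨n, hn⟩ := h 0 v hv hvb
  refine ⟨n, v, hv, fun x hx => ?_⟩
  have e := hn x hx
  rw [map_zero_of_strictMono hf] at e
  simpa using e

theorem germ_one (f : thompsonF) : ∃ n : ℤ, ∃ u : unitInterval, u < 1 ∧
    ∀ x ∈ Icc u 1,
      1 - ((f : unitInterval ≃ₜ unitInterval) x : ℝ) = (2 : ℝ) ^ n * (1 - (x : ℝ)) := by
  obtain ⟨f, hf, B, hB, h⟩ := f
  obtain ⟨u, hu, -, hub⟩ := exists_left_break B 1 zero_lt_one
  obtain ⟨n, hn⟩ := h u 1 hu hub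
  refine ⟨n, u, hu, fun x hx => ?_⟩
  have e := hn x hx
  have e1 := hn 1 ⟨hu.le, le_rfl⟩
  rw [map_one_of_strictMono hf] at e1
  rw [Set.Icc.coe_one] at e1
  change 1 - (f x : ℝ) = _
  linear_combination e1 - e

theorem slopeZero_eq {f : thompsonF} {n : ℤ} {v : unitInterval} (hv : 0 < v)
    (h : ∀ x ∈ Icc 0 v,
      ((f : unitInterval ≃ₜ unitInterval) x : ℝ) = (2 : ℝ) ^ n * (x : ℝ)) :
    slopeZero f = (2 : ℝ) ^ n := by
  have hv' : (0 : ℝ) < v := hv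
  have hd : HasDerivWithinAt (fun x : ℝ => (2 : ℝ) ^ n * x) ((2 : ℝ) ^ n) (Icc 0 1) 0 := by
    simpa using ((hasDerivAt_id (0 : ℝ)).const_mul ((2 : ℝ) ^ n)).hasDerivWithinAt
  have key : ∀ x : ℝ, x ∈ Icc (0 : ℝ) 1 → x < v → toReal f x = (2 : ℝ) ^ n * x := by
    intro x hx hxv
    have := h ⟨x, hx⟩ ⟨hx.1, hxv.le⟩
    simpa only [toReal, projIcc_of_mem zero_le_one hx] using this
  refine (hd.congr_of_eventuallyEq ?_ (key 0 (by simp) hv')).derivWithin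
    (uniqueDiffOn_Icc zero_lt_one 0 (by simp))
  filter_upwards [self_mem_nhdsWithin, mem_nhdsWithin_of_mem_nhds (Iio_mem_nhds hv')] with x hx hxv
  exact key x hx hxv

theorem slopeOne_eq {f : thompsonF} {n : ℤ} {u : unitInterval} (hu : u < 1)
    (h : ∀ x ∈ Icc u 1,
      1 - ((f : unitInterval ≃ₜ unitInterval) x : ℝ) = (2 : ℝ) ^ n * (1 - (x : ℝ))) :
    slopeOne f = (2 : ℝ) ^ n := by
  have hu' : (u : ℝ) < 1 := hu
  have hd : HasDerivWithinAt (fun x : ℝ => 1 - (2 : ℝ) ^ n * (1 - x)) ((2 : ℝ) ^ n)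
      (Icc 0 1) 1 := by
    have := ((((hasDerivAt_id (1 : ℝ)).const_sub 1).const_mul ((2 : ℝ) ^ n)).const_sub
      1).hasDerivWithinAt (s := Icc 0 1)
    simpa using this
  have key : ∀ x : ℝ, x ∈ Icc (0 : ℝ) 1 → u < x → toReal f x = 1 - (2 : ℝ) ^ n * (1 - x) := by
    intro x hx hxu
    have := h ⟨x, hx⟩ ⟨hxu.le, hx.2⟩
    simp only [toReal, projIcc_of_mem zero_le_one hx]
    linear_combination -this
  refine (hd.congr_of_eventuallyEq ?_ (key 1 (by simp) hu')).derivWithin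
    (uniqueDiffOn_Icc zero_lt_one 1 (by simp))
  filter_upwards [self_mem_nhdsWithin, mem_nhdsWithin_of_mem_nhds (Ioi_mem_nhds hu')] with x hx hxu
  exact key x hx hxu

theorem slopeZero_eq_zpow (f : thompsonF) : ∃ n : ℤ, slopeZero f = (2 : ℝ) ^ n := by
  obtain ⟨n, v, hv, h⟩ := germ_zero f
  exact ⟨n, slopeZero_eq hv h⟩

theorem slopeOne_eq_zpow (f : thompsonF) : ∃ n : ℤ, slopeOne f = (2 : ℝ) ^ n := by
  obtain ⟨n, v, hv, h⟩ := germ_one f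
  exact ⟨n, slopeOne_eq hv h⟩

theorem slopeZero_mul (f g : thompsonF) : slopeZero (f * g) = slopeZero f * slopeZero g := by
  obtain ⟨n, v, hv, h⟩ := germ_zero f
  obtain ⟨m, w, hw, k⟩ := germ_zero g
  have hg : StrictMono (g : unitInterval ≃ₜ unitInterval) := g.2.1
  have hg0 := map_zero_of_strictMono hg
  have hv' : 0 < (g : unitInterval ≃ₜ unitInterval).symm v := by
    rw [← hg.lt_iff_lt, hg0]; simpa using hv
  rw [slopeZero_eq hv h, slopeZero_eq hw k, ← zpow_add₀ two_ne_zero]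
  refine slopeZero_eq (lt_min hw hv') fun x hx => ?_
  have e1 := k x ⟨hx.1, hx.2.trans (min_le_left _ _)⟩
  have e2 := h ((g : unitInterval ≃ₜ unitInterval) x) ⟨unitInterval.nonneg', by
    simpa using hg.monotone (hx.2.trans (min_le_right _ _))⟩
  rw [e1] at e2
  rw [zpow_add₀ two_ne_zero, mul_assoc]
  exact e2

theorem slopeOne_mul (f g : thompsonF) : slopeOne (f * g) = slopeOne f * slopeOne g := by
  obtain ⟨n, v, hv, h⟩ := germ_one f
  obtain ⟨m, w, hw, k⟩ := germ_one g
  have hg : StrictMono (g : unitInterval ≃ₜ unitInterval) := g.2.1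
  have hg1 := map_one_of_strictMono hg
  have hv' : (g : unitInterval ≃ₜ unitInterval).symm v < 1 := by
    rw [← hg.lt_iff_lt, hg1]; simpa using hv
  rw [slopeOne_eq hv h, slopeOne_eq hw k, ← zpow_add₀ two_ne_zero]
  refine slopeOne_eq (max_lt hw hv') fun x hx => ?_
  have e1 := k x ⟨(le_max_left _ _).trans hx.1, hx.2⟩
  have e2 := h ((g : unitInterval ≃ₜ unitInterval) x) ⟨by
    simpa using hg.monotone ((le_max_right _ _).trans hx.1), unitInterval.le_one'⟩
  rw [e1] at e2
  rw [zpow_add₀ two_ne_zero, mul_assoc]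
  exact e2

theorem floor_logb_mul {x y : ℝ} (hx : ∃ n : ℤ, x = (2 : ℝ) ^ n) (hy : ∃ n : ℤ, y = (2 : ℝ) ^ n) :
    ⌊Real.logb 2 (x * y)⌋ = ⌊Real.logb 2 x⌋ + ⌊Real.logb 2 y⌋ := by
  obtain ⟨n, rfl⟩ := hx
  obtain ⟨m, rfl⟩ := hy
  have key : ∀ j : ℤ, Real.logb 2 ((2 : ℝ) ^ j) = j := fun j => by
    rw [← Real.rpow_intCast, Real.logb_rpow (by norm_num) (by norm_num)]
  rw [← zpow_add₀ two_ne_zero, key, key, key]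
  simp only [Int.floor_intCast]

/-- The homomorphism `φ : F → ℤ²`, `φ f = (log₂ (f' 0), log₂ (f' 1))`, with the group `ℤ²` written
multiplicatively. The logarithms are integers (see `coe_phi_fst` and `coe_phi_snd`), so that the
integer part only serves to view them in `ℤ`. -/
noncomputable def phi : thompsonF →* Multiplicative (ℤ × ℤ) :=
  MonoidHom.mk'
    (fun f => Multiplicative.ofAdd (⌊Real.logb 2 (slopeZero f)⌋, ⌊Real.logb 2 (slopeOne f)⌋))
    (fun f g => by
      rw [slopeZero_mul, slopeOne_mul,
        floor_logb_mul (slopeZero_eq_zpow f) (slopeZero_eq_zpow g),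
        floor_logb_mul (slopeOne_eq_zpow f) (slopeOne_eq_zpow g)]
      rfl)

theorem coe_floor_logb {x : ℝ} (hx : ∃ n : ℤ, x = (2 : ℝ) ^ n) :
    ((⌊Real.logb 2 x⌋ : ℤ) : ℝ) = Real.logb 2 x := by
  obtain ⟨n, rfl⟩ := hx
  rw [← Real.rpow_intCast, Real.logb_rpow (by norm_num) (by norm_num), Int.floor_intCast]

theorem coe_phi_fst (f : thompsonF) :
    ((Multiplicative.toAdd (phi f)).1 : ℝ) = Real.logb 2 (slopeZero f) :=
  coe_floor_logb (slopeZero_eq_zpow f)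

theorem coe_phi_snd (f : thompsonF) :
    ((Multiplicative.toAdd (phi f)).2 : ℝ) = Real.logb 2 (slopeOne f) :=
  coe_floor_logb (slopeOne_eq_zpow f)

/-- The rectangular subgroup `⟨(a, 0), (0, b)⟩` of `ℤ²`. -/
def rectZ (a b : ℕ) : Subgroup (Multiplicative (ℤ × ℤ)) :=
  Subgroup.closure {Multiplicative.ofAdd ((a : ℤ), (0 : ℤ)), Multiplicative.ofAdd ((0 : ℤ), (b : ℤ))}

/-- The subgroup `K_(a,b)` of `F`, the preimage under `φ` of `⟨(a, 0), (0, b)⟩`. -/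
noncomputable def rectF (a b : ℕ) : Subgroup thompsonF := (rectZ a b).comap phi

/-- The restriction of `φ` to a homomorphism from `K_(a,b)` to `⟨(a, 0), (0, b)⟩`. -/
noncomputable def phiRect (a b : ℕ) : rectF a b →* rectZ a b := phi.subgroupComap (rectZ a b)

/-- The rectangular subgroups of `F` are the `K_(a,b)` with `a` and `b` positive. -/
def IsRectangular (K : Subgroup thompsonF) : Prop := ∃ a b : ℕ, 0 < a ∧ 0 < b ∧ K = rectF a b

/-- `K` is `Inner H`, the maximal rectangular subgroup of `H`: a rectangular group contained in `H`
that contains every rectangular group contained in `H`. -/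
def IsInner (H K : Subgroup thompsonF) : Prop := IsGreatest {L | IsRectangular L ∧ L ≤ H} K

/-- The group `Q = φ(H) / ⟨(a, 0), (0, b)⟩`. -/
abbrev QuotientQ (H : Subgroup thompsonF) (a b : ℕ) : Type :=
  (H.map phi) ⧸ (rectZ a b).subgroupOf (H.map phi)

end Thompson

/-!
The proof takes place on the line. A piecewise linear bijection `toUnit` from the line to `(0, 1)`,
sending the integers to `…, 1/4, 1/2, 3/4, …`, conjugates `F` onto `lineGroup 1 1`: the increasing
dyadic piecewise linear bijections of the line that are translations by integers near `-∞` and near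
`+∞` (`range_lineHom`). The homomorphism `phi` becomes the translation length near `-∞` together
with minus the translation length near `+∞`. Piecewise linearity is handled locally, as a property
of germs (`IsDyadicPLAt`) that is stable under composition and division; compactness turns it back
into finitely many breaks (`exists_uniform_subdivision`).

*Finite index subgroups contain `ker phi`.* The line group is generated by translation by `1` and by
the maps `double i` that double `[i, i + 1]` (`lineGroup_le_of_generators`): after magnifying domain
and range one may assume that all breaks are integers and all slopes at least `1`, and then doubling
maps can be split off one at a time. Translation moves `double i` to `double (i + 1)`, so that `F`
is generated by two elements whose images under `phi` are linearly independent, and `ker phi` is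
contained in the commutator subgroup. In a finite quotient conjugation by the translation is
periodic, and the relation `double i * double j = double (j + 1) * double i` for `i < j` then makes
the two generators commute (`commute_genShift_genDouble`). So a finite index subgroup contains the
commutator subgroup, hence `ker phi`, and is the preimage of its image.

*`K_(a,b)` is isomorphic to `F`.* On the line `K_(a,b)` is `lineGroup a b`, where the translation
lengths at the two ends are multiples of `a` and of `b`. A piecewise linear bijection of the line
with infinitely many breaks that maps `[0, b]` onto `[0, 1]` and `[-a, 0]` onto `[-1, 0]`, and is
continued equivariantly on both sides, conjugates it onto `lineGroup 1 1` (`conj_rescale_mem_iff`).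

*The inner rectangular group.* What remains concerns a finite index subgroup `L` of `ℤ²`. The
numbers `a` and `b` are the generators of its intersections with the axes, and an element of `L` is
determined modulo `rectZ a b` by its first coordinate, so that the quotient is cyclic.
-/

namespace Thompson
open Filter Topology

/-! ### Dyadic affine germs -/

/-- `f` agrees along the filter `l` with an affine map whose slope is a power of two and whose
constant term is dyadic. With `l` one of `𝓝[≥] x`, `𝓝[≤] x`, `𝓝 x` this is a statement about the
germ of `f` at `x`, from one side or from both. -/
def IsDyadicAffineAlong (f : ℝ → ℝ) (l : Filter ℝ) : Prop :=
  ∃ (n : ℤ) (c : ℝ), IsDyadic c ∧ ∀ᶠ y in l, f y = 2 ^ n * y + c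

/-- `f` is dyadic piecewise linear near `x`: both one-sided germs are dyadic affine, and they are
the same germ unless `x` is dyadic. The point `x` itself belongs to both sides, so that this entails
continuity at `x`. -/
def IsDyadicPLAt (f : ℝ → ℝ) (x : ℝ) : Prop :=
  IsDyadicAffineAlong f (𝓝[≥] x) ∧ IsDyadicAffineAlong f (𝓝[≤] x) ∧
    (¬ IsDyadic x → IsDyadicAffineAlong f (𝓝 x))

theorem isDyadic_intCast (m : ℤ) : IsDyadic m := ⟨m, 0, by simp⟩

theorem isDyadic_zpow (n : ℤ) : IsDyadic ((2 : ℝ) ^ n) := by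
  simpa using (isDyadic_intCast 1).zpow_mul n

theorem isDyadic_affine_iff {n : ℤ} {c : ℝ} (hc : IsDyadic c) (x : ℝ) :
    IsDyadic (2 ^ n * x + c) ↔ IsDyadic x := by
  refine ⟨fun h => ?_, fun h => (h.zpow_mul n).add hc⟩
  have := (h.add hc.neg).zpow_mul (-n)
  rwa [add_neg_cancel_right, zpow_neg, inv_mul_cancel_left₀ (by positivity)] at this

/-- The map `y ↦ 2 ^ n * y + c` as an order isomorphism of the line. -/
noncomputable def affineIso (n : ℤ) (c : ℝ) : ℝ ≃o ℝ :=
  (OrderIso.mulLeft₀ ((2 : ℝ) ^ n) (by positivity)).trans (OrderIso.addRight c)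

theorem affineIso_apply (n : ℤ) (c y : ℝ) : affineIso n c y = 2 ^ n * y + c := rfl

theorem map_nhdsWithin_orderIso (e : ℝ ≃o ℝ) (s : Set ℝ) (x : ℝ) :
    map e (𝓝[s] x) = 𝓝[e '' s] (e x) :=
  e.toHomeomorph.isEmbedding.map_nhdsWithin_eq s x

theorem IsDyadicAffineAlong.map_nhdsGE {f : ℝ → ℝ} {x : ℝ}
    (h : IsDyadicAffineAlong f (𝓝[≥] x)) : map f (𝓝[≥] x) = 𝓝[≥] (f x) := by
  obtain ⟨n, c, -, h⟩ := h
  rw [Filter.map_congr (m₂ := affineIso n c) h, map_nhdsWithin_orderIso, OrderIso.image_Ici,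
    affineIso_apply, h.self_of_nhdsWithin self_mem_Ici]

theorem IsDyadicAffineAlong.map_nhdsLE {f : ℝ → ℝ} {x : ℝ}
    (h : IsDyadicAffineAlong f (𝓝[≤] x)) : map f (𝓝[≤] x) = 𝓝[≤] (f x) := by
  obtain ⟨n, c, -, h⟩ := h
  rw [Filter.map_congr (m₂ := affineIso n c) h, map_nhdsWithin_orderIso, OrderIso.image_Iic,
    affineIso_apply, h.self_of_nhdsWithin self_mem_Iic]

theorem IsDyadicAffineAlong.map_nhds {f : ℝ → ℝ} {x : ℝ}
    (h : IsDyadicAffineAlong f (𝓝 x)) : map f (𝓝 x) = 𝓝 (f x) := by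
  obtain ⟨n, c, -, h⟩ := h
  rw [Filter.map_congr (m₂ := affineIso n c) h, ← nhdsWithin_univ, map_nhdsWithin_orderIso,
    image_univ_of_surjective (affineIso n c).surjective, nhdsWithin_univ, affineIso_apply,
    h.self_of_nhds]

theorem IsDyadicAffineAlong.congr {f g : ℝ → ℝ} {l : Filter ℝ} (h : IsDyadicAffineAlong f l)
    (hfg : f =ᶠ[l] g) : IsDyadicAffineAlong g l := by
  obtain ⟨n, c, hc, h⟩ := h
  exact ⟨n, c, hc, by filter_upwards [h, hfg] with y h1 h2; rw [← h2, h1]⟩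

theorem IsDyadicAffineAlong.mono {f : ℝ → ℝ} {l l' : Filter ℝ} (h : IsDyadicAffineAlong f l)
    (hl : l' ≤ l) : IsDyadicAffineAlong f l' := by
  obtain ⟨n, c, hc, h⟩ := h
  exact ⟨n, c, hc, h.filter_mono hl⟩

theorem IsDyadicAffineAlong.comp {f g : ℝ → ℝ} {l : Filter ℝ}
    (hf : IsDyadicAffineAlong f (map g l)) (hg : IsDyadicAffineAlong g l) :
    IsDyadicAffineAlong (f ∘ g) l := by
  obtain ⟨n, c, hc, hf⟩ := hf
  obtain ⟨m, d, hd, hg⟩ := hg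
  refine ⟨n + m, 2 ^ n * d + c, (hd.zpow_mul n).add hc, ?_⟩
  filter_upwards [hg, eventually_map.1 hf] with y h1 h2
  rw [Function.comp_apply, h2, h1, zpow_add₀ two_ne_zero]
  ring

/-- Dyadic affine germs can be divided on the right. -/
theorem IsDyadicAffineAlong.of_comp {f g : ℝ → ℝ} {l : Filter ℝ}
    (hf : IsDyadicAffineAlong (f ∘ g) l) (hg : IsDyadicAffineAlong g l) :
    IsDyadicAffineAlong f (map g l) := by
  obtain ⟨n, c, hc, hf⟩ := hf
  obtain ⟨m, d, hd, hg⟩ := hg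
  refine ⟨n + -m, c + -(2 ^ (n + -m) * d), hc.add (hd.zpow_mul _).neg, ?_⟩
  rw [eventually_map]
  filter_upwards [hg, hf] with y h1 h2
  rw [Function.comp_apply] at h2
  rw [h2, h1, zpow_add₀ two_ne_zero, zpow_neg]
  field_simp
  ring

theorem IsDyadicPLAt.isDyadic_iff {f : ℝ → ℝ} {x : ℝ} (h : IsDyadicPLAt f x) :
    IsDyadic (f x) ↔ IsDyadic x := by
  obtain ⟨⟨n, c, hc, h⟩, -⟩ := h
  rw [h.self_of_nhdsWithin self_mem_Ici, isDyadic_affine_iff hc]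

theorem IsDyadicPLAt.of_nhds {f : ℝ → ℝ} {x : ℝ} (h : IsDyadicAffineAlong f (𝓝 x)) :
    IsDyadicPLAt f x :=
  ⟨h.mono nhdsWithin_le_nhds, h.mono nhdsWithin_le_nhds, fun _ => h⟩

theorem IsDyadicPLAt.congr {f g : ℝ → ℝ} {x : ℝ} (h : IsDyadicPLAt f x) (hfg : f =ᶠ[𝓝 x] g) :
    IsDyadicPLAt g x :=
  ⟨h.1.congr (hfg.filter_mono nhdsWithin_le_nhds), h.2.1.congr (hfg.filter_mono nhdsWithin_le_nhds),
    fun hx => (h.2.2 hx).congr hfg⟩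

theorem IsDyadicPLAt.comp {f g : ℝ → ℝ} {x : ℝ} (hf : IsDyadicPLAt f (g x))
    (hg : IsDyadicPLAt g x) : IsDyadicPLAt (f ∘ g) x := by
  refine ⟨.comp ?_ hg.1, .comp ?_ hg.2.1, fun hx => .comp ?_ (hg.2.2 hx)⟩
  · rw [hg.1.map_nhdsGE]; exact hf.1
  · rw [hg.2.1.map_nhdsLE]; exact hf.2.1
  · rw [(hg.2.2 hx).map_nhds]; exact hf.2.2 (mt hg.isDyadic_iff.1 hx)

theorem IsDyadicPLAt.of_comp {f g : ℝ → ℝ} {x : ℝ} (hf : IsDyadicPLAt (f ∘ g) x)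
    (hg : IsDyadicPLAt g x) : IsDyadicPLAt f (g x) := by
  refine ⟨?_, ?_, fun hx => ?_⟩
  · rw [← hg.1.map_nhdsGE]; exact hf.1.of_comp hg.1
  · rw [← hg.2.1.map_nhdsLE]; exact hf.2.1.of_comp hg.2.1
  · rw [hg.isDyadic_iff] at hx
    rw [← (hg.2.2 hx).map_nhds]; exact (hf.2.2 hx).of_comp (hg.2.2 hx)

/-! ### From local to global -/

/-- If `(j/2^k, (j+1)/2^k)` is short and meets a small neighbourhood of a point near which `f` is
dyadic piecewise linear, then `f` is affine on it: a dyadic `x` is not interior to the interval once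
`2 ^ k` is a multiple of its denominator. -/
theorem IsDyadicPLAt.exists_nhds {f : ℝ → ℝ} {x : ℝ} (h : IsDyadicPLAt f x) :
    ∃ t ∈ 𝓝 x, ∃ K N : ℕ, ∀ k ≥ K, ∀ j : ℤ, ∀ z ∈ t,
      z ∈ Icc ((j : ℝ) / 2 ^ k) ((j + 1) / 2 ^ k) → ∃ (n : ℤ) (c : ℝ), -(N : ℤ) ≤ n ∧
        ∀ y ∈ Icc ((j : ℝ) / 2 ^ k) ((j + 1) / 2 ^ k), f y = 2 ^ n * y + c := by
  have small : ∀ ε > 0, ∃ K : ℕ, ∀ k ≥ K, ∀ (j : ℤ), ∀ z ∈ Metric.ball x (ε / 2),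
      z ∈ Icc ((j : ℝ) / 2 ^ k) ((j + 1) / 2 ^ k) →
      ∀ y ∈ Icc ((j : ℝ) / 2 ^ k) ((j + 1) / 2 ^ k), y ∈ Metric.ball x ε := by
    intro ε hε
    obtain ⟨K, hK⟩ := exists_pow_lt_of_lt_one (half_pos hε) (one_half_lt_one (α := ℝ))
    refine ⟨K, fun k hk j z hz hzj y hy => ?_⟩
    have hk' : ((1 : ℝ) / 2) ^ k < ε / 2 :=
      (pow_le_pow_of_le_one (by norm_num) (by norm_num) hk).trans_lt hK
    rw [one_div, inv_pow] at hk'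
    rw [add_div, one_div] at hzj hy
    rw [Metric.mem_ball, Real.dist_eq, abs_lt] at hz ⊢
    constructor <;> linarith [hz.1, hz.2, hzj.1, hzj.2, hy.1, hy.2]
  by_cases hx : IsDyadic x
  · obtain ⟨⟨n, c, -, hR⟩, ⟨m, d, -, hL⟩, -⟩ := h
    obtain ⟨ε, hε, hR⟩ := Metric.mem_nhdsWithin_iff.1 hR
    obtain ⟨δ, hδ, hL⟩ := Metric.mem_nhdsWithin_iff.1 hL
    obtain ⟨K, hK⟩ := small (min ε δ) (lt_min hε hδ)
    obtain ⟨p, M, hp⟩ := hx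
    refine ⟨_, Metric.ball_mem_nhds x (half_pos (lt_min hε hδ)), max K M, n.natAbs + m.natAbs, ?_⟩
    intro k hk j z hz hzj
    have hin := hK k (le_of_max_le_left hk) j z hz hzj
    have hk0 : (0 : ℝ) < 2 ^ k := by positivity
    obtain ⟨q, hq⟩ : ∃ q : ℤ, x = q / 2 ^ k := by
      refine ⟨p * 2 ^ (k - M), ?_⟩
      have : (2 : ℝ) ^ k = 2 ^ (k - M) * 2 ^ M := by
        rw [← pow_add, Nat.sub_add_cancel (le_of_max_le_right hk)]
      rw [hp, this]
      push_cast
      field_simp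
    rcases le_or_gt q j with hqj | hqj
    · refine ⟨n, c, by omega, fun y hy => hR ⟨?_, ?_⟩⟩
      · exact Metric.ball_subset_ball (min_le_left _ _) (hin y hy)
      · refine le_trans ?_ hy.1
        rw [hq]
        gcongr
    · refine ⟨m, d, by omega, fun y hy => hL ⟨?_, ?_⟩⟩
      · exact Metric.ball_subset_ball (min_le_right _ _) (hin y hy)
      · refine hy.2.trans ?_
        rw [hq]
        gcongr
        exact_mod_cast hqj
  · obtain ⟨n, c, -, h⟩ := h.2.2 hx
    obtain ⟨ε, hε, h⟩ := Metric.mem_nhds_iff.1 h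
    obtain ⟨K, hK⟩ := small ε hε
    exact ⟨_, Metric.ball_mem_nhds x (half_pos hε), K, n.natAbs, fun k hk j z hz hzj =>
      ⟨n, c, by omega, fun y hy => h (hK k hk j z hz hzj y hy)⟩⟩

/-- On a compact set, being locally dyadic piecewise linear is witnessed by a uniform subdivision
into intervals of length `2 ^ (-k)`, and the slopes are bounded below. -/
theorem exists_uniform_subdivision {f : ℝ → ℝ} {S : Set ℝ} (hS : IsCompact S)
    (h : ∀ x ∈ S, IsDyadicPLAt f x) :
    ∃ K N : ℕ, ∀ k ≥ K, ∀ j : ℤ, ∀ z ∈ S,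
      z ∈ Icc ((j : ℝ) / 2 ^ k) ((j + 1) / 2 ^ k) → ∃ (n : ℤ) (c : ℝ), -(N : ℤ) ≤ n ∧
        ∀ y ∈ Icc ((j : ℝ) / 2 ^ k) ((j + 1) / 2 ^ k), f y = 2 ^ n * y + c := by
  refine hS.induction_on (p := fun S => ∃ K N : ℕ, ∀ k ≥ K, ∀ j : ℤ, ∀ z ∈ S,
    z ∈ Icc ((j : ℝ) / 2 ^ k) ((j + 1) / 2 ^ k) → ∃ (n : ℤ) (c : ℝ), -(N : ℤ) ≤ n ∧
      ∀ y ∈ Icc ((j : ℝ) / 2 ^ k) ((j + 1) / 2 ^ k), f y = 2 ^ n * y + c) ⟨0, 0, by simp⟩ ?_ ?_ ?_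
  · rintro s t hst ⟨K, N, h⟩
    exact ⟨K, N, fun k hk j z hz => h k hk j z (hst hz)⟩
  · rintro s t ⟨K, N, h⟩ ⟨K', N', h'⟩
    refine ⟨max K K', max N N', fun k hk j z hz hzj => ?_⟩
    rcases hz with hz | hz
    · obtain ⟨n, c, hn, e⟩ := h k (le_of_max_le_left hk) j z hz hzj
      exact ⟨n, c, by omega, e⟩
    · obtain ⟨n, c, hn, e⟩ := h' k (le_of_max_le_right hk) j z hz hzj
      exact ⟨n, c, by omega, e⟩
  · intro x hx
    obtain ⟨t, ht, h⟩ := (h x hx).exists_nhds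
    exact ⟨t, mem_nhdsWithin_of_mem_nhds ht, h⟩

/-! ### Interpolation of sequences -/

/-- The function that takes the value `s k` at each integer `k` and is affine in between. -/
noncomputable def interp (s : ℤ → ℝ) (t : ℝ) : ℝ :=
  s ⌊t⌋ + (s (⌊t⌋ + 1) - s ⌊t⌋) * (t - ⌊t⌋)

/-- The values `s k` are dyadic and each increment `s (k + 1) - s k` is a power of two. -/
def IsDyadicSeq (s : ℤ → ℝ) : Prop :=
  IsDyadic (s 0) ∧ ∀ k, ∃ n : ℤ, s (k + 1) = s k + 2 ^ n

theorem interp_of_mem_Icc (s : ℤ → ℝ) {k : ℤ} {t : ℝ} (ht : t ∈ Icc (k : ℝ) (k + 1)) :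
    interp s t = s k + (s (k + 1) - s k) * (t - k) := by
  rcases ht.2.eq_or_lt with rfl | h
  · have : ⌊(k : ℝ) + 1⌋ = k + 1 := by exact_mod_cast Int.floor_intCast (R := ℝ) (k + 1)
    rw [interp, this]; push_cast; ring
  · rw [interp, Int.floor_eq_iff.2 ⟨ht.1, h⟩]

theorem interp_intCast (s : ℤ → ℝ) (k : ℤ) : interp s k = s k := by
  rw [interp_of_mem_Icc s (k := k) ⟨le_rfl, by simp⟩]; simp

/-- A functional equation of a sequence passes to its interpolation. -/
theorem interp_add_intCast {s : ℤ → ℝ} {t A B : ℝ} {p : ℤ} (h0 : s (⌊t⌋ + p) = A * s ⌊t⌋ + B)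
    (h1 : s (⌊t⌋ + 1 + p) = A * s (⌊t⌋ + 1) + B) :
    interp s (t + p) = A * interp s t + B := by
  rw [interp, interp, Int.floor_add_intCast, h0, add_right_comm ⌊t⌋ p 1, h1]
  push_cast
  ring

namespace IsDyadicSeq

variable {s : ℤ → ℝ} (hs : IsDyadicSeq s)
include hs

theorem strictMono : StrictMono s :=
  strictMono_int_of_lt_succ fun k => by
    obtain ⟨n, hn⟩ := hs.2 k
    rw [hn]
    have : (0 : ℝ) < 2 ^ n := by positivity
    linarith

theorem isDyadic (k : ℤ) : IsDyadic (s k) := by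
  induction k using Int.induction_on with
  | zero => exact hs.1
  | succ i ih =>
    obtain ⟨n, hn⟩ := hs.2 i
    rw [hn]
    exact ih.add (isDyadic_zpow n)
  | pred i ih =>
    obtain ⟨n, hn⟩ := hs.2 (-i - 1)
    rw [sub_add_cancel] at hn
    rw [eq_sub_of_add_eq hn.symm, sub_eq_add_neg]
    exact ih.add (isDyadic_zpow n).neg

theorem interp_strictMono : StrictMono (interp s) := by
  intro t u htu
  have hpos : 0 < s (⌊t⌋ + 1) - s ⌊t⌋ := sub_pos.2 (hs.strictMono (lt_add_one _))
  rcases (Int.floor_mono htu.le).eq_or_lt with h | h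
  · rw [interp, interp, ← h]
    gcongr
  · calc interp s t < s (⌊t⌋ + 1) := by
          rw [interp]
          nlinarith [Int.lt_floor_add_one t]
      _ ≤ s ⌊u⌋ := hs.strictMono.monotone h
      _ ≤ interp s u := by
          rw [interp]
          have := sub_pos.2 (hs.strictMono (lt_add_one ⌊u⌋))
          nlinarith [Int.floor_le u]

theorem exists_eq_on_Icc (k : ℤ) : ∃ (n : ℤ) (c : ℝ), IsDyadic c ∧
    ∀ y ∈ Icc (k : ℝ) (k + 1), interp s y = 2 ^ n * y + c := by
  obtain ⟨n, hn⟩ := hs.2 k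
  refine ⟨n, s k + -(2 ^ n * k), (hs.isDyadic k).add ((isDyadic_intCast k).zpow_mul n).neg, ?_⟩
  intro y hy
  rw [interp_of_mem_Icc s hy, hn]
  ring

theorem isDyadicPLAt_interp (x : ℝ) : IsDyadicPLAt (interp s) x := by
  by_cases hx : (⌊x⌋ : ℝ) = x
  · have hd : IsDyadic x := hx ▸ isDyadic_intCast _
    obtain ⟨n, c, hc, h⟩ := hs.exists_eq_on_Icc ⌊x⌋
    obtain ⟨m, d, hd', h'⟩ := hs.exists_eq_on_Icc (⌊x⌋ - 1)
    push_cast at h'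
    rw [sub_add_cancel, hx] at h'
    rw [hx] at h
    refine ⟨⟨n, c, hc, ?_⟩, ⟨m, d, hd', ?_⟩, fun h => absurd hd h⟩
    · filter_upwards [Icc_mem_nhdsGE (lt_add_one x)] with y hy using h y hy
    · filter_upwards [Icc_mem_nhdsLE (sub_one_lt x)] with y hy using h' y hy
  · refine .of_nhds ?_
    obtain ⟨n, c, hc, h⟩ := hs.exists_eq_on_Icc ⌊x⌋
    refine ⟨n, c, hc, ?_⟩
    filter_upwards [Icc_mem_nhds ((Int.floor_le x).lt_of_ne hx) (Int.lt_floor_add_one x)]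
      with y hy using h y hy

theorem exists_interp_eq {y : ℝ} (hl : ∃ k, s k ≤ y) (hu : ∃ k, y < s k) :
    ∃ t, interp s t = y := by
  obtain ⟨l, hl⟩ := hl
  obtain ⟨u, hu⟩ := hu
  obtain ⟨k, hk, hmax⟩ := Int.exists_greatest_of_bdd (P := fun k => s k ≤ y)
    ⟨u, fun z hz => (hs.strictMono.lt_iff_lt.1 (hz.trans_lt hu)).le⟩ ⟨l, hl⟩
  have hk1 : y < s (k + 1) := not_le.1 fun h => by
    have := hmax _ h
    omega
  have hpos : 0 < s (k + 1) - s k := sub_pos.2 (hs.strictMono (lt_add_one _))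
  refine ⟨k + (y - s k) / (s (k + 1) - s k), ?_⟩
  rw [interp_of_mem_Icc s (k := k)]
  · field_simp
    ring
  · constructor
    · have : 0 ≤ (y - s k) / (s (k + 1) - s k) := div_nonneg (by linarith) hpos.le
      linarith
    · have : (y - s k) / (s (k + 1) - s k) ≤ 1 := (div_le_one hpos).2 (by linarith)
      linarith

/-- The interpolation of a sequence that is unbounded on both sides, as an order isomorphism. -/
noncomputable def interpIso (hb : ∀ y, (∃ k, s k ≤ y) ∧ ∃ k, y < s k) : ℝ ≃o ℝ :=
  hs.interp_strictMono.orderIsoOfSurjective _ fun y => hs.exists_interp_eq (hb y).1 (hb y).2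

end IsDyadicSeq

/-! ### Piecewise linear groups of the line -/

/-- The locally dyadic piecewise linear order isomorphisms of the line; they may have infinitely
many breaks. -/
def plLine : Subgroup (ℝ ≃o ℝ) where
  carrier := {f | ∀ x, IsDyadicPLAt f x}
  one_mem' x := .of_nhds ⟨0, 0, .zero, by simp⟩
  mul_mem' hf hg x := (hf _).comp (hg x)
  inv_mem' {f} hf x := by
    have h : IsDyadicPLAt (⇑f⁻¹ ∘ f) (f⁻¹ x) :=
      .of_nhds ⟨0, 0, .zero, by simp⟩
    simpa using h.of_comp (hf _)

/-- The dyadic piecewise linear order isomorphisms of the line that are translations by a multiple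
of `a` near `-∞` and by a multiple of `b` near `+∞`. -/
def lineGroup (a b : ℕ) : Subgroup (ℝ ≃o ℝ) where
  carrier := {f | f ∈ plLine ∧ (∃ m : ℤ, ∀ᶠ t in atBot, f t = t + (a * m : ℤ)) ∧
    ∃ n : ℤ, ∀ᶠ t in atTop, f t = t + (b * n : ℤ)}
  one_mem' := ⟨one_mem _, ⟨0, by simp⟩, 0, by simp⟩
  mul_mem' := by
    rintro f g ⟨hf, ⟨m, hm⟩, n, hn⟩ ⟨hg, ⟨m', hm'⟩, n', hn'⟩
    refine ⟨mul_mem hf hg, ⟨m + m', ?_⟩, n + n', ?_⟩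
    · filter_upwards [hm', g.tendsto_atBot.eventually hm] with t h1 h2
      rw [RelIso.mul_apply, h2, h1]
      push_cast
      ring
    · filter_upwards [hn', g.tendsto_atTop.eventually hn] with t h1 h2
      rw [RelIso.mul_apply, h2, h1]
      push_cast
      ring
  inv_mem' := by
    rintro f ⟨hf, ⟨m, hm⟩, n, hn⟩
    refine ⟨inv_mem hf, ⟨-m, ?_⟩, -n, ?_⟩
    · filter_upwards [(f⁻¹).tendsto_atBot.eventually hm] with t h
      rw [RelIso.apply_inv_self] at h
      push_cast at h ⊢
      linarith
    · filter_upwards [(f⁻¹).tendsto_atTop.eventually hn] with t h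
      rw [RelIso.apply_inv_self] at h
      push_cast at h ⊢
      linarith

theorem mem_lineGroup {a b : ℕ} {f : ℝ ≃o ℝ} : f ∈ lineGroup a b ↔ f ∈ plLine ∧
    (∃ m : ℤ, ∀ᶠ t in atBot, f t = t + (a * m : ℤ)) ∧
    ∃ n : ℤ, ∀ᶠ t in atTop, f t = t + (b * n : ℤ) := Iff.rfl

/-! ### Rescaling the ends of the line -/

/-- The sequence that cuts each interval `[q, q + 1]` into `a` intervals, of lengths
`1/2, 1/4, …, 2 ^ (1 - a), 2 ^ (1 - a)`. The rounded-down division makes it satisfy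
`cutSeq a (k + a) = cutSeq a k + 1` for negative `k` as well. -/
noncomputable def cutSeq (a : ℕ) (k : ℤ) : ℝ := (k / a : ℤ) + 1 - 2 ^ (-(k % a))

theorem cutSeq_zero (a : ℕ) : cutSeq a 0 = 0 := by simp [cutSeq]

theorem cutSeq_add_mul {a : ℕ} (ha : 0 < a) (k n : ℤ) :
    cutSeq a (k + a * n) = cutSeq a k + n := by
  rw [cutSeq, cutSeq, Int.add_mul_ediv_left _ _ (by omega), Int.add_mul_emod_self_left]
  push_cast
  ring

theorem cutSeq_succ {a : ℕ} (ha : 0 < a) (k : ℤ) :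
    ∃ n : ℤ, cutSeq a (k + 1) = cutSeq a k + 2 ^ n := by
  have ha' : (0 : ℤ) < a := by exact_mod_cast ha
  have h0 := Int.emod_nonneg k ha'.ne'
  have h1 := Int.emod_lt_of_pos k ha'
  have hk := Int.emod_add_mul_ediv k a
  have e : ∀ r q : ℤ, 0 ≤ r → r < a → cutSeq a (r + a * q) = q + 1 - 2 ^ (-r) := by
    intro r q hr hra
    rw [cutSeq_add_mul ha, cutSeq, Int.ediv_eq_zero_of_lt hr hra, Int.emod_eq_of_lt hr hra]
    push_cast
    ring
  have hk' := e _ (k / a) h0 h1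
  rw [hk] at hk'
  rcases (show k % a + 1 ≤ a from h1).eq_or_lt with h | h
  · refine ⟨-(k % a), ?_⟩
    have := e 0 (k / a + 1) le_rfl ha'
    rw [show 0 + (a : ℤ) * (k / a + 1) = k + 1 by linarith] at this
    rw [this, hk']
    push_cast
    ring
  · refine ⟨-(k % a) - 1, ?_⟩
    have := e (k % a + 1) (k / a) (by omega) h
    rw [add_right_comm, hk] at this
    rw [this, hk', neg_add, ← sub_eq_add_neg, zpow_sub_one₀ two_ne_zero]
    ring

/-- The sequence `cutSeq b` on the right half of the line and `cutSeq a` on the left half. -/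
noncomputable def cutSeq₂ (a b : ℕ) (k : ℤ) : ℝ := if 0 ≤ k then cutSeq b k else cutSeq a k

theorem cutSeq₂_of_nonneg (a b : ℕ) {k : ℤ} (hk : 0 ≤ k) : cutSeq₂ a b k = cutSeq b k := if_pos hk

theorem cutSeq₂_of_nonpos (a b : ℕ) {k : ℤ} (hk : k ≤ 0) : cutSeq₂ a b k = cutSeq a k := by
  rcases hk.eq_or_lt with rfl | hk
  · simp [cutSeq₂, cutSeq_zero]
  · exact if_neg hk.not_ge

section

variable {a b : ℕ}

theorem isDyadicSeq_cutSeq₂ (ha : 0 < a) (hb : 0 < b) : IsDyadicSeq (cutSeq₂ a b) := by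
  refine ⟨by simpa [cutSeq₂, cutSeq_zero] using IsDyadic.zero, fun k => ?_⟩
  rcases le_or_gt 0 k with hk | hk
  · simpa [cutSeq₂_of_nonneg, hk, hk.trans (lt_add_one k).le] using cutSeq_succ hb k
  · simpa [cutSeq₂_of_nonpos, hk.le, Int.add_one_le_of_lt hk] using cutSeq_succ ha k

theorem cutSeq₂_unbounded (ha : 0 < a) (hb : 0 < b) (y : ℝ) :
    (∃ k, cutSeq₂ a b k ≤ y) ∧ ∃ k, y < cutSeq₂ a b k := by
  constructor
  · refine ⟨0 + a * min 0 ⌊y⌋, ?_⟩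
    have h : 0 + (a : ℤ) * min 0 ⌊y⌋ ≤ 0 := by
      rw [zero_add]
      exact mul_nonpos_of_nonneg_of_nonpos (Int.natCast_nonneg a) (min_le_left 0 ⌊y⌋)
    rw [cutSeq₂_of_nonpos _ _ h, cutSeq_add_mul ha, cutSeq_zero, zero_add]
    exact le_trans (by exact_mod_cast min_le_right _ _) (Int.floor_le y)
  · refine ⟨0 + b * max 0 (⌊y⌋ + 1), ?_⟩
    rw [cutSeq₂_of_nonneg _ _ (by positivity), cutSeq_add_mul hb, cutSeq_zero,
      zero_add]
    refine (Int.lt_floor_add_one y).trans_le ?_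
    exact_mod_cast le_max_right 0 (⌊y⌋ + 1)

theorem interp_cutSeq₂_add (hb : 0 < b) {t : ℝ} {n : ℤ} (h : 0 ≤ t) (h' : 0 ≤ t + (b * n : ℤ)) :
    interp (cutSeq₂ a b) (t + (b * n : ℤ)) = interp (cutSeq₂ a b) t + n := by
  have h0 : 0 ≤ ⌊t⌋ := Int.floor_nonneg.2 h
  have h1 : 0 ≤ ⌊t⌋ + b * n := by rw [← Int.floor_add_intCast]; exact Int.floor_nonneg.2 h'
  rw [interp_add_intCast (A := 1) (B := n), one_mul]
  · rw [cutSeq₂_of_nonneg _ _ h0, cutSeq₂_of_nonneg _ _ h1, cutSeq_add_mul hb, one_mul]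
  · rw [cutSeq₂_of_nonneg _ _ (by omega), cutSeq₂_of_nonneg _ _ (by omega), cutSeq_add_mul hb,
      one_mul]

theorem interp_cutSeq₂_add_of_neg (ha : 0 < a) {t : ℝ} {n : ℤ} (h : t < 0)
    (h' : t + (a * n : ℤ) < 0) :
    interp (cutSeq₂ a b) (t + (a * n : ℤ)) = interp (cutSeq₂ a b) t + n := by
  have h0 : ⌊t⌋ < 0 := Int.floor_lt_zero.2 h
  have h1 : ⌊t⌋ + a * n < 0 := by rw [← Int.floor_add_intCast]; exact Int.floor_lt_zero.2 h'
  rw [interp_add_intCast (A := 1) (B := n), one_mul]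
  · rw [cutSeq₂_of_nonpos _ _ h0.le, cutSeq₂_of_nonpos _ _ h1.le, cutSeq_add_mul ha, one_mul]
  · rw [cutSeq₂_of_nonpos _ _ (by omega), cutSeq₂_of_nonpos _ _ (by omega), cutSeq_add_mul ha,
      one_mul]

/-- The order isomorphism of the line that conjugates translation by `b` near `+∞`, and translation
by `a` near `-∞`, into translation by `1`. -/
noncomputable def rescale (ha : 0 < a) (hb : 0 < b) : ℝ ≃o ℝ :=
  (isDyadicSeq_cutSeq₂ ha hb).interpIso (cutSeq₂_unbounded ha hb)

theorem rescale_mem (ha : 0 < a) (hb : 0 < b) : rescale ha hb ∈ plLine :=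
  (isDyadicSeq_cutSeq₂ ha hb).isDyadicPLAt_interp

theorem rescale_add (ha : 0 < a) (hb : 0 < b) (n : ℤ) :
    ∀ᶠ t in atTop, rescale ha hb (t + (b * n : ℤ)) = rescale ha hb t + (n : ℤ) := by
  filter_upwards [eventually_ge_atTop 0, eventually_ge_atTop (-((b * n : ℤ) : ℝ))] with t h0 h1
  exact interp_cutSeq₂_add hb h0 (by linarith)

theorem rescale_add_atBot (ha : 0 < a) (hb : 0 < b) (n : ℤ) :
    ∀ᶠ t in atBot, rescale ha hb (t + (a * n : ℤ)) = rescale ha hb t + (n : ℤ) := by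
  filter_upwards [eventually_lt_atBot 0, eventually_lt_atBot (-((a * n : ℤ) : ℝ))] with t h0 h1
  exact interp_cutSeq₂_add_of_neg ha h0 (by linarith)

theorem conj_rescale_mem_iff (ha : 0 < a) (hb : 0 < b) (f : ℝ ≃o ℝ) :
    rescale ha hb * f * (rescale ha hb)⁻¹ ∈ lineGroup 1 1 ↔ f ∈ lineGroup a b := by
  set S := rescale ha hb
  have hS : S ∈ plLine := rescale_mem ha hb
  rw [mem_lineGroup, mem_lineGroup]
  refine and_congr ?_ (and_congr (exists_congr fun n => ?_) (exists_congr fun n => ?_))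
  · rw [mul_mem_cancel_right (inv_mem hS), mul_mem_cancel_left hS]
  · conv_lhs => rw [← S.map_atBot, eventually_map]
    refine eventually_congr ?_
    filter_upwards [rescale_add_atBot ha hb n] with t ht
    rw [RelIso.mul_apply, RelIso.mul_apply, RelIso.inv_apply_self, Nat.cast_one, one_mul, ← ht]
    exact S.injective.eq_iff
  · conv_lhs => rw [← S.map_atTop, eventually_map]
    refine eventually_congr ?_
    filter_upwards [rescale_add ha hb n] with t ht
    rw [RelIso.mul_apply, RelIso.mul_apply, RelIso.inv_apply_self, Nat.cast_one, one_mul, ← ht]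
    exact S.injective.eq_iff

theorem nonempty_lineGroup_mulEquiv (ha : 0 < a) (hb : 0 < b) :
    Nonempty (lineGroup 1 1 ≃* lineGroup a b) := by
  have h : (lineGroup a b).map (MulAut.conj (rescale ha hb)).toMonoidHom = lineGroup 1 1 := by
    ext f
    obtain ⟨g, rfl⟩ := (MulAut.conj (rescale ha hb)).surjective f
    rw [Subgroup.mem_map_equiv, MulEquiv.symm_apply_apply, MulAut.conj_apply, conj_rescale_mem_iff]
  rw [← h]
  exact ⟨((lineGroup a b).equivMapOfInjective _ (MulAut.conj _).injective).symm⟩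

end

/-! ### Generators of the line group -/

/-- The sequence with increments `2 ^ k` between `A` and `B` and increments `1` elsewhere. -/
noncomputable def stretchSeq (A B : ℤ) (k : ℕ) (j : ℤ) : ℝ :=
  j + (2 ^ k - 1) * (max A (min j B) - A : ℤ)

theorem isDyadicSeq_stretchSeq {A B : ℤ} (h : A ≤ B) (k : ℕ) :
    IsDyadicSeq (stretchSeq A B k) := by
  constructor
  · have : stretchSeq A B k 0 = ((2 ^ k - 1) * (max A (min 0 B) - A) : ℤ) := by
      simp [stretchSeq]
    rw [this]
    exact isDyadic_intCast _
  · intro j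
    by_cases hj : A ≤ j ∧ j < B
    · refine ⟨k, ?_⟩
      have : max A (min (j + 1) B) - A = max A (min j B) - A + 1 := by omega
      rw [stretchSeq, stretchSeq, this]
      push_cast
      rw [zpow_natCast]
      ring
    · refine ⟨0, ?_⟩
      have : max A (min (j + 1) B) - A = max A (min j B) - A := by omega
      rw [stretchSeq, stretchSeq, this]
      push_cast
      ring

theorem stretchSeq_unbounded (A B : ℤ) (k : ℕ) (y : ℝ) :
    (∃ j, stretchSeq A B k j ≤ y) ∧ ∃ j, y < stretchSeq A B k j := by
  constructor
  · refine ⟨min A ⌊y⌋, ?_⟩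
    have : max A (min (min A ⌊y⌋) B) - A = 0 := by omega
    rw [stretchSeq, this, Int.cast_zero, mul_zero, add_zero]
    exact le_trans (by exact_mod_cast min_le_right _ _) (Int.floor_le y)
  · refine ⟨⌊y⌋ + 1, ?_⟩
    have h1 : (0 : ℝ) ≤ (max A (min (⌊y⌋ + 1) B) - A : ℤ) := by
      exact_mod_cast (by omega : 0 ≤ max A (min (⌊y⌋ + 1) B) - A)
    have h2 : (0 : ℝ) ≤ 2 ^ k - 1 := sub_nonneg.2 (one_le_pow₀ one_le_two)
    have := mul_nonneg h2 h1
    rw [stretchSeq, Int.cast_add, Int.cast_one]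
    linarith [Int.lt_floor_add_one y]

/-- The order isomorphism of the line that is the identity up to `A`, has slope `2 ^ k` between `A`
and `B`, and is a translation from `B` on. -/
noncomputable def stretch {A B : ℤ} (h : A ≤ B) (k : ℕ) : ℝ ≃o ℝ :=
  (isDyadicSeq_stretchSeq h k).interpIso (stretchSeq_unbounded A B k)

section

variable {A B : ℤ} (h : A ≤ B) (k : ℕ) {t : ℝ}

theorem stretch_mem : stretch h k ∈ plLine := (isDyadicSeq_stretchSeq h k).isDyadicPLAt_interp

theorem stretch_intCast (j : ℤ) : stretch h k j = stretchSeq A B k j := interp_intCast _ j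

theorem stretch_eq_of_floor (j : ℤ) (ht : t ∈ Icc (j : ℝ) (j + 1)) :
    stretch h k t = stretchSeq A B k j +
      (stretchSeq A B k (j + 1) - stretchSeq A B k j) * (t - j) := interp_of_mem_Icc _ ht

theorem stretch_of_le (ht : t ≤ A) : stretch h k t = t := by
  have hc : (⌈t⌉ : ℝ) - 1 ≤ t := by linarith [Int.ceil_lt_add_one t]
  have hA : ⌈t⌉ ≤ A := Int.ceil_le.2 ht
  rw [stretch_eq_of_floor h k (⌈t⌉ - 1) (by push_cast; exact ⟨hc, by linarith [Int.le_ceil t]⟩)]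
  have h1 : max A (min (⌈t⌉ - 1) B) - A = 0 := by omega
  have h2 : max A (min (⌈t⌉ - 1 + 1) B) - A = 0 := by omega
  rw [stretchSeq, stretchSeq, h1, h2]
  push_cast
  ring

theorem stretch_of_mem_Icc (ht : A ≤ t) (ht' : t ≤ B) :
    stretch h k t = A + 2 ^ k * (t - A) := by
  rcases ht'.eq_or_lt with rfl | ht'
  · rw [stretch_intCast, stretchSeq, min_self, max_eq_right h]
    push_cast
    ring
  · have hA : A ≤ ⌊t⌋ := Int.le_floor.2 ht
    have hB : ⌊t⌋ < B := Int.floor_lt.2 ht'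
    rw [stretch_eq_of_floor h k ⌊t⌋ ⟨Int.floor_le t, (Int.lt_floor_add_one t).le⟩]
    have h1 : max A (min ⌊t⌋ B) - A = ⌊t⌋ - A := by omega
    have h2 : max A (min (⌊t⌋ + 1) B) - A = ⌊t⌋ + 1 - A := by omega
    rw [stretchSeq, stretchSeq, h1, h2]
    push_cast
    ring

theorem stretch_of_ge (ht : B ≤ t) : stretch h k t = t + (2 ^ k - 1) * (B - A) := by
  have hB : B ≤ ⌊t⌋ := Int.le_floor.2 ht
  rw [stretch_eq_of_floor h k ⌊t⌋ ⟨Int.floor_le t, (Int.lt_floor_add_one t).le⟩]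
  have h1 : max A (min ⌊t⌋ B) - A = B - A := by omega
  have h2 : max A (min (⌊t⌋ + 1) B) - A = B - A := by omega
  rw [stretchSeq, stretchSeq, h1, h2]
  push_cast
  ring

theorem stretch_symm_of_le (ht : t ≤ A) : (stretch h k).symm t = t := by
  rw [OrderIso.symm_apply_eq, stretch_of_le h k ht]

theorem stretch_symm_of_mem_Icc (ht : A ≤ t) (ht' : t ≤ A + 2 ^ k * (B - A)) :
    (stretch h k).symm t = A + (t - A) / 2 ^ k := by
  rw [OrderIso.symm_apply_eq, stretch_of_mem_Icc]
  · field_simp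
    ring
  · have : 0 ≤ (t - A) / 2 ^ k := div_nonneg (by linarith) (by positivity)
    linarith
  · have : (t - A) / 2 ^ k ≤ B - A := by
      rw [div_le_iff₀ (by positivity)]
      linarith
    linarith

theorem stretch_symm_of_ge (ht : A + 2 ^ k * (B - A) ≤ t) :
    (stretch h k).symm t = t - (2 ^ k - 1) * (B - A) := by
  rw [OrderIso.symm_apply_eq, stretch_of_ge h k (by linarith)]
  ring

end

/-- The generator that doubles the interval `[i, i + 1]`: it is the identity up to `i`, has slope
`2` on `[i, i + 1]`, and is translation by `1` from `i + 1` on. -/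
noncomputable def double (i : ℤ) : ℝ ≃o ℝ := stretch (lt_add_one i).le 1

theorem double_of_le {i : ℤ} {t : ℝ} (ht : t ≤ i) : double i t = t := stretch_of_le _ _ ht

theorem double_of_mem_Icc {i : ℤ} {t : ℝ} (ht : i ≤ t) (ht' : t ≤ i + 1) :
    double i t = i + 2 * (t - i) := by
  rw [double, stretch_of_mem_Icc _ _ ht (by push_cast; exact ht'), pow_one]

theorem double_of_ge {i : ℤ} {t : ℝ} (ht : i + 1 ≤ t) : double i t = t + 1 := by
  rw [double, stretch_of_ge _ _ (by push_cast; exact ht)]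
  push_cast
  ring

theorem double_symm_of_le {i : ℤ} {t : ℝ} (ht : t ≤ i) : (double i).symm t = t :=
  stretch_symm_of_le _ _ ht

theorem double_symm_of_mem_Icc {i : ℤ} {t : ℝ} (ht : i ≤ t) (ht' : t ≤ i + 2) :
    (double i).symm t = i + (t - i) / 2 := by
  rw [double, stretch_symm_of_mem_Icc _ _ ht (by push_cast; linarith), pow_one]

theorem double_symm_of_ge {i : ℤ} {t : ℝ} (ht : i + 2 ≤ t) : (double i).symm t = t - 1 := by
  rw [double, stretch_symm_of_ge _ _ (by push_cast; linarith)]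
  push_cast
  ring

/-- Translation of the line by the integer `n`. -/
noncomputable def shift (n : ℤ) : ℝ ≃o ℝ := OrderIso.addRight (n : ℝ)

theorem shift_apply (n : ℤ) (t : ℝ) : shift n t = t + n := rfl

theorem shift_zpow (n : ℤ) : shift 1 ^ n = shift n := by
  induction n using Int.induction_on with
  | zero => ext t; simp [shift_apply]
  | succ i ih => rw [zpow_add_one, ih]; ext t; simp [shift_apply, add_right_comm, add_assoc]
  | pred i ih =>
    rw [zpow_sub_one, ih, mul_inv_eq_iff_eq_mul]; ext t; simp [shift_apply]

theorem double_mul_double {i j : ℤ} (h : i < j) :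
    double i * double j = double (j + 1) * double i := by
  have hij : (i : ℝ) + 1 ≤ j := by exact_mod_cast h
  ext t
  rw [RelIso.mul_apply, RelIso.mul_apply]
  rcases le_total t j with hj | hj
  · rw [double_of_le hj, double_of_le (i := j + 1)]
    push_cast
    rcases le_total t (i + 1) with hi | hi
    · refine ((double i).monotone hi).trans ?_
      rw [double_of_ge le_rfl]
      linarith
    · rw [double_of_ge hi]
      linarith
  · rw [double_of_ge (i := i) (t := t) (by linarith)]
    rcases le_total t (j + 1) with hj' | hj'
    · rw [double_of_mem_Icc hj hj', double_of_ge (by linarith), double_of_mem_Icc] <;> push_cast <;>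
        linarith
    · rw [double_of_ge hj', double_of_ge (by linarith), double_of_ge]
      push_cast
      linarith

theorem shift_mul_double (n i : ℤ) : shift n * double i = double (i + n) * shift n := by
  ext t
  rw [RelIso.mul_apply, RelIso.mul_apply, shift_apply, shift_apply]
  rcases le_total t i with h | h
  · rw [double_of_le h, double_of_le]
    push_cast
    linarith
  rcases le_total t (i + 1) with h' | h'
  · rw [double_of_mem_Icc h h', double_of_mem_Icc] <;> push_cast <;> linarith
  · rw [double_of_ge h', double_of_ge] <;> push_cast <;> linarith

/-- The maps that are affine on each interval between consecutive integers, with slope a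
nonnegative power of two. -/
def IsExpanding (f : ℝ → ℝ) : Prop :=
  ∀ j : ℤ, ∃ n : ℕ, ∀ t ∈ Icc (j : ℝ) (j + 1), f t = f j + 2 ^ n * (t - j)

namespace IsExpanding

variable {f : ℝ → ℝ}

theorem displacement_mono (hf : IsExpanding f) : Monotone fun j : ℤ => f j - j := by
  refine monotone_int_of_le_succ fun j => ?_
  obtain ⟨n, hn⟩ := hf j
  have h := hn (j + 1) ⟨by linarith, le_rfl⟩
  have : (1 : ℝ) ≤ 2 ^ n := one_le_pow₀ one_le_two
  push_cast
  rw [h]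
  linarith

theorem eq_self (hf : IsExpanding f) {A : ℤ} (hA : ∀ t ≤ (A : ℝ), f t = t)
    (h : ∀ j : ℤ, f (j + 1) = f j + 1) (t : ℝ) : f t = t := by
  have hint : ∀ j : ℤ, f j = j := fun j => by
    induction j using Int.inductionOn' (b := A) with
    | zero => exact hA A le_rfl
    | succ k _ ih => push_cast; rw [h, ih]
    | pred k _ ih =>
      have := h (k - 1)
      push_cast at this ⊢
      rw [sub_add_cancel, ih] at this
      linarith
  obtain ⟨n, hn⟩ := hf ⌊t⌋
  have h1 := hn (⌊t⌋ + 1) ⟨by linarith, le_rfl⟩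
  rw [h, add_sub_cancel_left, mul_one] at h1
  rw [hn t ⟨Int.floor_le t, (Int.lt_floor_add_one t).le⟩, hint, ← add_left_cancel h1]
  ring

theorem comp_double_symm (hf : IsExpanding f) {j : ℤ} {n : ℕ}
    (hn : ∀ t ∈ Icc (j : ℝ) (j + 1), f t = f j + 2 ^ (n + 1) * (t - j)) :
    IsExpanding (f ∘ (double j).symm) := by
  intro i
  rcases lt_or_ge i j with hi | hi
  · have hij : (i : ℝ) + 1 ≤ j := by exact_mod_cast hi
    obtain ⟨m, hm⟩ := hf i
    refine ⟨m, fun t ht => ?_⟩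
    rw [Function.comp_apply, Function.comp_apply, double_symm_of_le (ht.2.trans hij),
      double_symm_of_le (by linarith), hm t ht]
  rcases le_or_gt i (j + 1) with hi' | hi'
  · have hij : (j : ℝ) ≤ i := by exact_mod_cast hi
    have hij' : (i : ℝ) ≤ j + 1 := by exact_mod_cast hi'
    refine ⟨n, fun t ht => ?_⟩
    rw [Function.comp_apply, Function.comp_apply,
      double_symm_of_mem_Icc (hij.trans ht.1) (by linarith [ht.2]),
      double_symm_of_mem_Icc hij (by linarith),
      hn (j + (t - j) / 2) ⟨by linarith [ht.1], by linarith [ht.2]⟩,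
      hn (j + (i - j) / 2) ⟨by linarith, by linarith⟩]
    ring
  · have hij : (j : ℝ) + 2 ≤ i := by exact_mod_cast (by omega : j + 2 ≤ i)
    obtain ⟨m, hm⟩ := hf (i - 1)
    push_cast at hm
    refine ⟨m, fun t ht => ?_⟩
    rw [Function.comp_apply, Function.comp_apply, double_symm_of_ge (by linarith [ht.1]),
      double_symm_of_ge hij, hm _ ⟨by linarith [ht.1], by linarith [ht.2]⟩]
    ring

end IsExpanding

/-- An expanding map that moves the far right by `m` is a product of `m` doubling maps: an interval
of slope at least `2` allows one to split off a doubling map on the right, and this decreases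
`m` by one. -/
theorem IsExpanding.mem_of_natCast {C : Subgroup (ℝ ≃o ℝ)} (hC : ∀ i, double i ∈ C) (m : ℕ) :
    ∀ (f : ℝ ≃o ℝ), IsExpanding f → (∃ A : ℤ, ∀ t ≤ (A : ℝ), f t = t) →
      (∃ B : ℤ, ∀ t ≥ (B : ℝ), f t = t + m) → f ∈ C := by
  induction m with
  | zero =>
    rintro f hf ⟨A, hA⟩ ⟨B, hB⟩
    have h0 : ∀ j : ℤ, f j = j := by
      intro j
      have h1 := hf.displacement_mono (min_le_right A j)
      have h2 := hf.displacement_mono (le_max_right B j)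
      dsimp only at h1 h2
      rw [hA (min A j : ℤ) (by exact_mod_cast min_le_left A j)] at h1
      rw [hB (max B j : ℤ) (by exact_mod_cast le_max_left B j), Nat.cast_zero] at h2
      linarith
    have : f = 1 := by
      ext t
      refine hf.eq_self hA (fun j => ?_) t
      have := h0 (j + 1)
      push_cast at this
      rw [this, h0]
    exact this ▸ one_mem C
  | succ m ih =>
    rintro f hf ⟨A, hA⟩ ⟨B, hB⟩
    by_cases hall : ∀ j : ℤ, f (j + 1) = f j + 1
    · have := hf.eq_self hA hall B
      rw [hB B le_rfl] at this
      push_cast at this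
      have : (0 : ℝ) ≤ m := m.cast_nonneg
      linarith
    push Not at hall
    obtain ⟨j, hj⟩ := hall
    obtain ⟨n, hn⟩ := hf j
    rcases n with - | n
    · rw [hn (j + 1) ⟨by linarith, le_rfl⟩] at hj
      simp at hj
    have key : f * (double j)⁻¹ ∈ C := by
      refine ih _ (hf.comp_double_symm hn) ⟨min A j, fun t ht => ?_⟩ ⟨max (B + 1) (j + 2), ?_⟩
      · push_cast at ht
        change f ((double j).symm t) = t
        rw [double_symm_of_le (ht.trans (min_le_right _ _)), hA t (ht.trans (min_le_left _ _))]
      · intro t ht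
        push_cast at ht
        have h1 := (le_max_left _ _).trans ht
        have h2 := (le_max_right _ _).trans ht
        change f ((double j).symm t) = _
        rw [double_symm_of_ge h2, hB _ (by linarith)]
        push_cast
        ring
    simpa using mul_mem key (hC j)

theorem IsExpanding.mem {C : Subgroup (ℝ ≃o ℝ)} (hC : ∀ i, double i ∈ C) {f : ℝ ≃o ℝ}
    (hf : IsExpanding f) {A B m : ℤ} (hA : ∀ t ≤ (A : ℝ), f t = t)
    (hB : ∀ t ≥ (B : ℝ), f t = t + m) : f ∈ C := by
  have h := hf.displacement_mono (min_le_right A B)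
  dsimp only at h
  rw [hA (min A B : ℤ) (by exact_mod_cast min_le_left A B), hB _ le_rfl, sub_self,
    add_sub_cancel_left] at h
  lift m to ℕ using by exact_mod_cast h
  exact IsExpanding.mem_of_natCast hC m f hf ⟨A, hA⟩ ⟨B, fun t ht => by simpa using hB t ht⟩

theorem stretch_isExpanding {A B : ℤ} (h : A ≤ B) (k : ℕ) : IsExpanding (stretch h k) := by
  intro j
  by_cases hj : A ≤ j ∧ j < B
  · have h1 : (A : ℝ) ≤ j := by exact_mod_cast hj.1
    have h2 : (j : ℝ) + 1 ≤ B := by exact_mod_cast hj.2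
    refine ⟨k, fun t ht => ?_⟩
    rw [stretch_of_mem_Icc h k (h1.trans ht.1) (ht.2.trans h2), stretch_of_mem_Icc h k h1
      (by linarith)]
    ring
  refine ⟨0, fun t ht => ?_⟩
  rcases lt_or_ge j A with hA | hA
  · have h1 : (j : ℝ) + 1 ≤ A := by exact_mod_cast hA
    rw [stretch_of_le h k (ht.2.trans h1), stretch_of_le h k (by linarith)]
    ring
  · have h1 : (B : ℝ) ≤ j := by exact_mod_cast (by omega : B ≤ j)
    rw [stretch_of_ge h k (h1.trans ht.1), stretch_of_ge h k h1]
    ring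

theorem stretch_mem_of_double {C : Subgroup (ℝ ≃o ℝ)} (hC : ∀ i, double i ∈ C) {A B : ℤ}
    (h : A ≤ B) (k : ℕ) : stretch h k ∈ C :=
  (stretch_isExpanding h k).mem hC (A := A) (B := B) (m := (2 ^ k - 1) * (B - A))
    (fun _ => stretch_of_le h k) fun t ht => by rw [stretch_of_ge h k ht]; push_cast; ring

/-- An element that is the identity far left becomes expanding after magnifying its domain, to make
all breaks integral, and its range, to make all slopes at least `1`. -/
theorem mem_of_double_of_eq_self {C : Subgroup (ℝ ≃o ℝ)} (hC : ∀ i, double i ∈ C) {f : ℝ ≃o ℝ}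
    (hf : f ∈ plLine) {A B n : ℤ} (hAB : A ≤ B) (hA : ∀ t ≤ (A : ℝ), f t = t)
    (hB : ∀ t ≥ (B : ℝ), f t = t + n) : f ∈ C := by
  obtain ⟨k, N, hk⟩ := exists_uniform_subdivision (isCompact_Icc (a := (A : ℝ)) (b := B))
    fun x _ => hf x
  replace hk := hk k le_rfl
  have hAB' : (A : ℝ) ≤ B := by exact_mod_cast hAB
  have hABn : A ≤ B + n := by
    have := f.monotone hAB'
    rw [hA A le_rfl, hB B le_rfl] at this
    exact_mod_cast this
  have hpow : (1 : ℝ) ≤ 2 ^ k := one_le_pow₀ one_le_two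
  have hBk : (B : ℝ) ≤ A + 2 ^ k * (B - A) := by nlinarith
  set p := stretch hABn (N + k) with hp
  set q := stretch hAB k with hq
  have key : p * f * q⁻¹ ∈ C := by
    have hval : ∀ t, (p * f * q⁻¹) t = p (f (q.symm t)) := fun t => rfl
    have hlow : ∀ t ≤ (A : ℝ), (p * f * q⁻¹) t = t := fun t ht => by
      rw [hval, stretch_symm_of_le hAB k ht, hA t ht, stretch_of_le hABn _ ht]
    have hhigh : ∀ t ≥ ((A + 2 ^ k * (B - A) : ℤ) : ℝ), (p * f * q⁻¹) t =
        t + (n + (2 ^ (N + k) - 1) * (B + n - A) - (2 ^ k - 1) * (B - A) : ℤ) := fun t ht => by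
      push_cast at ht
      rw [hval, stretch_symm_of_ge hAB k ht, hB _ (by linarith), stretch_of_ge]
      · push_cast
        ring
      · push_cast
        linarith
    refine IsExpanding.mem hC (fun j => ?_) hlow hhigh
    rcases lt_or_ge j A with hj | hj
    · have h1 : (j : ℝ) + 1 ≤ A := by exact_mod_cast hj
      refine ⟨0, fun t ht => ?_⟩
      rw [hlow t (ht.2.trans h1), hlow j (by linarith)]
      ring
    rcases le_or_gt (A + 2 ^ k * (B - A)) j with hj' | hj'
    · have h1 : ((A + 2 ^ k * (B - A) : ℤ) : ℝ) ≤ j := by exact_mod_cast hj'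
      refine ⟨0, fun t ht => ?_⟩
      rw [hhigh t (h1.trans ht.1), hhigh j h1]
      ring
    have h1 : (A : ℝ) ≤ j := by exact_mod_cast hj
    have h2 : (j : ℝ) + 1 ≤ A + 2 ^ k * (B - A) := by exact_mod_cast hj'
    -- The preimage of `[j, j + 1]` under `q` is a subdivision interval.
    have hi : (((A * 2 ^ k + (j - A) : ℤ) : ℝ)) / 2 ^ k = A + (j - A) / 2 ^ k := by
      push_cast
      field_simp
    have hi' : (((A * 2 ^ k + (j - A) : ℤ) : ℝ) + 1) / 2 ^ k = A + (j + 1 - A) / 2 ^ k := by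
      push_cast
      field_simp
      ring
    have hk := hk (A * 2 ^ k + (j - A)) (A + (j - A) / 2 ^ k)
    rw [hi, hi'] at hk
    have hjB : A + ((j : ℝ) + 1 - A) / 2 ^ k ≤ B := by
      have : ((j : ℝ) + 1 - A) / 2 ^ k ≤ B - A := by
        rw [div_le_iff₀ (by positivity)]
        linarith
      linarith
    have hjj : A + ((j : ℝ) - A) / 2 ^ k ≤ A + ((j : ℝ) + 1 - A) / 2 ^ k := by
      gcongr
      linarith
    have hA0 : (A : ℝ) ≤ A + ((j : ℝ) - A) / 2 ^ k := by
      have : 0 ≤ ((j : ℝ) - A) / 2 ^ k := div_nonneg (by linarith) (by positivity)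
      linarith
    obtain ⟨m, c, hm, hfm⟩ := hk ⟨hA0, hjj.trans hjB⟩ ⟨le_rfl, hjj⟩
    obtain ⟨l, hl⟩ := Int.eq_ofNat_of_zero_le (by omega : 0 ≤ m + N)
    have hval' : ∀ t ∈ Icc (j : ℝ) (j + 1), (p * f * q⁻¹) t =
        A + 2 ^ (N + k) * (2 ^ m * (A + (t - A) / 2 ^ k) + c - A) := by
      intro t ht
      have e1 : A + ((j : ℝ) - A) / 2 ^ k ≤ A + (t - A) / 2 ^ k := by gcongr; exact ht.1
      have e2 : A + (t - A) / 2 ^ k ≤ A + ((j : ℝ) + 1 - A) / 2 ^ k := by gcongr; exact ht.2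
      have e3 := f.monotone (hA0.trans e1)
      have e4 := f.monotone (e2.trans hjB)
      rw [hA A le_rfl] at e3
      rw [hB B le_rfl] at e4
      rw [hval, stretch_symm_of_mem_Icc hAB k (h1.trans ht.1) (ht.2.trans h2),
        stretch_of_mem_Icc hABn _ e3 (by push_cast; exact e4), hfm _ ⟨e1, e2⟩]
    refine ⟨l, fun t ht => ?_⟩
    rw [hval' t ht, hval' j ⟨le_rfl, by linarith⟩]
    have hl' : (2 : ℝ) ^ l = 2 ^ m * 2 ^ N := by
      rw [← zpow_natCast, ← zpow_natCast, ← zpow_add₀ two_ne_zero, hl]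
    rw [hl', pow_add]
    field_simp
    ring
  have h1 := mul_mem (mul_mem (inv_mem (stretch_mem_of_double hC hABn (N + k))) key)
    (stretch_mem_of_double hC hAB k)
  rw [← hp, ← hq] at h1
  simpa [mul_assoc] using h1

theorem lineGroup_le_of_generators {C : Subgroup (ℝ ≃o ℝ)} (h0 : shift 1 ∈ C) (h1 : double 0 ∈ C) :
    lineGroup 1 1 ≤ C := by
  have hs : ∀ n, shift n ∈ C := fun n => shift_zpow n ▸ zpow_mem h0 n
  have hd : ∀ i, double i ∈ C := fun i => by
    have := shift_mul_double i 0
    rw [zero_add, ← mul_inv_eq_iff_eq_mul] at this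
    exact this ▸ mul_mem (mul_mem (hs i) h1) (inv_mem (hs i))
  rintro f ⟨hf, ⟨m, hm⟩, n, hn⟩
  obtain ⟨A, hA⟩ := eventually_atBot.1 hm
  obtain ⟨B, hB⟩ := eventually_atTop.1 hn
  simp only [Nat.cast_one, one_mul] at hA hB
  have hsm : shift (-m) ∈ plLine := fun x =>
    .of_nhds ⟨0, (-m : ℤ), isDyadic_intCast _, .of_forall fun y => by simp [shift_apply]⟩
  have key : shift (-m) * f ∈ C := by
    refine mem_of_double_of_eq_self hd (mul_mem hsm hf) (A := min ⌊A⌋ ⌈B⌉) (B := ⌈B⌉) (n := n - m)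
      (min_le_right _ _) (fun t ht => ?_) fun t ht => ?_
    · rw [RelIso.mul_apply, shift_apply, hA t]
      · push_cast; ring
      · exact ht.trans (le_trans (by exact_mod_cast min_le_left _ _) (Int.floor_le A))
    · rw [RelIso.mul_apply, shift_apply, hB t ((Int.le_ceil B).trans ht)]
      push_cast
      ring
  rwa [Subgroup.mul_mem_cancel_left _ (hs _)] at key

theorem shift_mem (n : ℤ) : shift n ∈ lineGroup 1 1 :=
  ⟨fun x => .of_nhds ⟨0, (n : ℤ), isDyadic_intCast _, .of_forall fun y => by simp [shift_apply]⟩,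
    ⟨n, by simp [shift_apply]⟩, n, by simp [shift_apply]⟩

theorem double_mem (i : ℤ) : double i ∈ lineGroup 1 1 := by
  refine ⟨stretch_mem _ _, ⟨0, ?_⟩, 1, ?_⟩
  · filter_upwards [eventually_le_atBot (i : ℝ)] with t ht
    rw [double_of_le ht]
    simp
  · filter_upwards [eventually_ge_atTop ((i : ℝ) + 1)] with t ht
    rw [double_of_ge ht]
    simp

/-! ### Transport to the line -/

/-- The sequence `…, 1/8, 1/4, 1/2, 3/4, 7/8, …`. -/
noncomputable def unitSeq (k : ℤ) : ℝ := if 0 ≤ k then 1 - 2 ^ (-k - 1) else 2 ^ (k - 1)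

theorem unitSeq_of_nonneg {k : ℤ} (hk : 0 ≤ k) : unitSeq k = 1 - 2 ^ (-k - 1) := if_pos hk

theorem unitSeq_of_nonpos {k : ℤ} (hk : k ≤ 0) : unitSeq k = 2 ^ (k - 1) := by
  rcases hk.eq_or_lt with rfl | hk
  · norm_num [unitSeq]
  · exact if_neg hk.not_ge

theorem isDyadicSeq_unitSeq : IsDyadicSeq unitSeq := by
  constructor
  · rw [unitSeq_of_nonpos le_rfl]
    exact isDyadic_zpow _
  · intro k
    rcases le_or_gt 0 k with hk | hk
    · refine ⟨-k - 2, ?_⟩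
      rw [unitSeq_of_nonneg hk, unitSeq_of_nonneg (by omega),
        show -k - 1 = (-k - 2) + 1 by ring, show -(k + 1) - 1 = -k - 2 by ring,
        zpow_add_one₀ two_ne_zero]
      ring
    · refine ⟨k - 1, ?_⟩
      rw [unitSeq_of_nonpos hk.le, unitSeq_of_nonpos (by omega),
        show k + 1 - 1 = (k - 1) + 1 by ring, zpow_add_one₀ two_ne_zero]
      ring

theorem unitSeq_mem_Ioo (k : ℤ) : unitSeq k ∈ Ioo (0 : ℝ) 1 := by
  rcases le_or_gt 0 k with hk | hk
  · rw [unitSeq_of_nonneg hk]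
    have h1 : (2 : ℝ) ^ (-k - 1) < 1 := zpow_lt_one_of_neg₀ one_lt_two (by omega)
    have h2 : (0 : ℝ) < 2 ^ (-k - 1) := by positivity
    constructor <;> linarith
  · rw [unitSeq_of_nonpos hk.le]
    exact ⟨by positivity, zpow_lt_one_of_neg₀ one_lt_two (by omega)⟩

/-- The piecewise linear increasing bijection from the line to `(0, 1)` that maps the integers to
`…, 1/8, 1/4, 1/2, 3/4, 7/8, …`. It conjugates multiplication by `2` near `0`, and division of the
distance to `1` by `2` near `1`, into translations by `1`. -/
noncomputable def toUnit : ℝ → ℝ := interp unitSeq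

theorem toUnit_strictMono : StrictMono toUnit := isDyadicSeq_unitSeq.interp_strictMono

theorem isDyadicPLAt_toUnit (t : ℝ) : IsDyadicPLAt toUnit t :=
  isDyadicSeq_unitSeq.isDyadicPLAt_interp t

theorem toUnit_mem_Ioo (t : ℝ) : toUnit t ∈ Ioo (0 : ℝ) 1 := by
  constructor
  · refine (unitSeq_mem_Ioo ⌊t⌋).1.trans_le ?_
    rw [← interp_intCast unitSeq]
    exact toUnit_strictMono.monotone (Int.floor_le t)
  · refine lt_of_le_of_lt ?_ (unitSeq_mem_Ioo ⌈t⌉).2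
    rw [← interp_intCast unitSeq]
    exact toUnit_strictMono.monotone (Int.le_ceil t)

theorem exists_unitSeq_lt {y : ℝ} (hy : 0 < y) : ∃ k, unitSeq k < y := by
  obtain ⟨n, hn⟩ := exists_pow_lt_of_lt_one hy (one_half_lt_one (α := ℝ))
  refine ⟨-n, ?_⟩
  rw [unitSeq_of_nonpos (by omega)]
  refine lt_of_le_of_lt ?_ hn
  rw [one_div, inv_pow, ← zpow_natCast, ← zpow_neg]
  exact zpow_le_zpow_right₀ one_le_two (by omega)

theorem exists_lt_unitSeq {y : ℝ} (hy : y < 1) : ∃ k, y < unitSeq k := by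
  obtain ⟨n, hn⟩ := exists_pow_lt_of_lt_one (sub_pos.2 hy) (one_half_lt_one (α := ℝ))
  refine ⟨n, ?_⟩
  rw [unitSeq_of_nonneg (by omega)]
  suffices (2 : ℝ) ^ (-(n : ℤ) - 1) < 1 - y by linarith
  refine lt_of_le_of_lt ?_ hn
  rw [one_div, inv_pow, ← zpow_natCast, ← zpow_neg]
  exact zpow_le_zpow_right₀ one_le_two (by omega)

theorem exists_toUnit_eq {y : ℝ} (h0 : 0 < y) (h1 : y < 1) : ∃ t, toUnit t = y := by
  obtain ⟨k, hk⟩ := exists_unitSeq_lt h0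
  obtain ⟨l, hl⟩ := exists_lt_unitSeq h1
  exact isDyadicSeq_unitSeq.exists_interp_eq ⟨k, hk.le⟩ ⟨l, hl⟩

theorem toUnit_add_of_neg {t : ℝ} {n : ℤ} (h : t < 0) (h' : t + n < 0) :
    toUnit (t + n) = 2 ^ n * toUnit t := by
  have h0 : ⌊t⌋ < 0 := Int.floor_lt_zero.2 h
  have h1 : ⌊t⌋ + n < 0 := by rw [← Int.floor_add_intCast]; exact Int.floor_lt_zero.2 h'
  rw [toUnit, interp_add_intCast (A := 2 ^ n) (B := 0), add_zero] <;>
  · rw [unitSeq_of_nonpos (by omega), unitSeq_of_nonpos (by omega), ← zpow_add₀ two_ne_zero,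
      add_zero]
    ring_nf

theorem one_sub_toUnit_sub {t : ℝ} {n : ℤ} (h : 0 ≤ t) (h' : 0 ≤ t - n) :
    1 - toUnit (t - n) = 2 ^ n * (1 - toUnit t) := by
  have h0 : 0 ≤ ⌊t⌋ := Int.floor_nonneg.2 h
  have h1 : 0 ≤ ⌊t⌋ + -n := by
    rw [← Int.floor_add_intCast, Int.cast_neg, ← sub_eq_add_neg]; exact Int.floor_nonneg.2 h'
  have e : t - n = t + (-n : ℤ) := by push_cast; ring
  have key : ∀ k : ℤ, 0 ≤ k → 0 ≤ k + -n → unitSeq (k + -n) = 2 ^ n * unitSeq k + (1 - 2 ^ n) := by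
    intro k hk hkn
    rw [unitSeq_of_nonneg hk, unitSeq_of_nonneg hkn, mul_sub, ← zpow_add₀ two_ne_zero]
    ring_nf
  rw [e, toUnit, interp_add_intCast (A := 2 ^ n) (B := 1 - 2 ^ n) (key _ h0 h1)
    (key _ (by omega) (by omega))]
  ring

/-- `toUnit` with values in the unit interval. -/
noncomputable def toUnitInterval (t : ℝ) : unitInterval :=
  ⟨toUnit t, (toUnit_mem_Ioo t).1.le, (toUnit_mem_Ioo t).2.le⟩

theorem coe_toUnitInterval (t : ℝ) : (toUnitInterval t : ℝ) = toUnit t := rfl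

theorem toUnitInterval_strictMono : StrictMono toUnitInterval := toUnit_strictMono

theorem toUnitInterval_pos (t : ℝ) : 0 < toUnitInterval t := (toUnit_mem_Ioo t).1

theorem toUnitInterval_lt_one (t : ℝ) : toUnitInterval t < 1 := (toUnit_mem_Ioo t).2

/-- The inverse of `toUnitInterval` on the open interval; its values at `0` and `1` are
irrelevant. -/
noncomputable def ofUnitInterval : unitInterval → ℝ := Function.invFun toUnitInterval

theorem ofUnitInterval_toUnitInterval (t : ℝ) : ofUnitInterval (toUnitInterval t) = t :=
  Function.leftInverse_invFun toUnitInterval_strictMono.injective t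

theorem toUnitInterval_ofUnitInterval {x : unitInterval} (h0 : 0 < x) (h1 : x < 1) :
    toUnitInterval (ofUnitInterval x) = x := by
  obtain ⟨t, ht⟩ := exists_toUnit_eq (y := x) h0 h1
  exact Function.invFun_eq ⟨t, Subtype.ext ht⟩

theorem pos_of_strictMono {f : unitInterval ≃ₜ unitInterval} (hf : StrictMono f) {x : unitInterval}
    (hx : 0 < x) : 0 < f x := map_zero_of_strictMono hf ▸ hf hx

theorem lt_one_of_strictMono {f : unitInterval ≃ₜ unitInterval} (hf : StrictMono f)
    {x : unitInterval} (hx : x < 1) : f x < 1 := (hf hx).trans_eq (map_one_of_strictMono hf)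

theorem toUnitInterval_conj {f : unitInterval ≃ₜ unitInterval} (hf : StrictMono f) (t : ℝ) :
    toUnitInterval (ofUnitInterval (f (toUnitInterval t))) = f (toUnitInterval t) :=
  toUnitInterval_ofUnitInterval (pos_of_strictMono hf (toUnitInterval_pos t))
    (lt_one_of_strictMono hf (toUnitInterval_lt_one t))

/-- The homeomorphism of `(0, 1)` underlying an element of `F`, transported to the line. -/
noncomputable def lineMap (f : thompsonF) : ℝ ≃o ℝ where
  toFun t := ofUnitInterval ((f : unitInterval ≃ₜ unitInterval) (toUnitInterval t))
  invFun t := ofUnitInterval ((f : unitInterval ≃ₜ unitInterval).symm (toUnitInterval t))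
  left_inv t := by
    dsimp only
    rw [toUnitInterval_conj f.2.1, Homeomorph.symm_apply_apply, ofUnitInterval_toUnitInterval]
  right_inv t := by
    dsimp only
    rw [toUnitInterval_conj (strictMono_symm f.2.1), Homeomorph.apply_symm_apply,
      ofUnitInterval_toUnitInterval]
  map_rel_iff' {s t} := by
    rw [← toUnitInterval_strictMono.le_iff_le]
    simp only [Equiv.coe_fn_mk]
    rw [toUnitInterval_conj f.2.1, toUnitInterval_conj f.2.1, f.2.1.le_iff_le,
      toUnitInterval_strictMono.le_iff_le]

theorem toUnitInterval_lineMap (f : thompsonF) (t : ℝ) :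
    toUnitInterval (lineMap f t) = (f : unitInterval ≃ₜ unitInterval) (toUnitInterval t) :=
  toUnitInterval_conj f.2.1 t

theorem toUnit_lineMap (f : thompsonF) (t : ℝ) :
    toUnit (lineMap f t) = (f : unitInterval ≃ₜ unitInterval) (toUnitInterval t) :=
  congrArg Subtype.val (toUnitInterval_lineMap f t)

/-- Transport to the line, as a homomorphism. -/
noncomputable def lineHom : thompsonF →* (ℝ ≃o ℝ) :=
  MonoidHom.mk' lineMap fun f g => by
    ext t
    apply toUnitInterval_strictMono.injective
    rw [RelIso.mul_apply, toUnitInterval_lineMap, toUnitInterval_lineMap, toUnitInterval_lineMap]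
    rfl

theorem lineHom_apply (f : thompsonF) : lineHom f = lineMap f := rfl

theorem lineHom_injective : Function.Injective lineHom := by
  intro f g h
  apply Subtype.ext
  ext x
  rcases (unitInterval.nonneg' (t := x)).eq_or_lt with rfl | h0
  · rw [map_zero_of_strictMono f.2.1, map_zero_of_strictMono g.2.1]
  rcases (unitInterval.le_one' (t := x)).eq_or_lt with rfl | h1
  · rw [map_one_of_strictMono f.2.1, map_one_of_strictMono g.2.1]
  rw [← toUnitInterval_ofUnitInterval h0 h1, ← toUnitInterval_lineMap, ← toUnitInterval_lineMap,
    ← lineHom_apply, h, lineHom_apply]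

theorem phi_fst_eq {f : thompsonF} {n : ℤ} {v : unitInterval} (hv : 0 < v)
    (h : ∀ x ∈ Icc 0 v, ((f : unitInterval ≃ₜ unitInterval) x : ℝ) = (2 : ℝ) ^ n * (x : ℝ)) :
    (phi f).toAdd.1 = n := by
  have h1 := coe_phi_fst f
  rw [slopeZero_eq hv h, ← Real.rpow_intCast, Real.logb_rpow (by norm_num) (by norm_num)] at h1
  exact_mod_cast h1

theorem phi_snd_eq {f : thompsonF} {n : ℤ} {u : unitInterval} (hu : u < 1)
    (h : ∀ x ∈ Icc u 1,
      1 - ((f : unitInterval ≃ₜ unitInterval) x : ℝ) = (2 : ℝ) ^ n * (1 - (x : ℝ))) :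
    (phi f).toAdd.2 = n := by
  have h1 := coe_phi_snd f
  rw [slopeOne_eq hu h, ← Real.rpow_intCast, Real.logb_rpow (by norm_num) (by norm_num)] at h1
  exact_mod_cast h1

theorem eventually_toUnit_lt {y : ℝ} (hy : 0 < y) : ∀ᶠ t in atBot, toUnit t < y := by
  obtain ⟨k, hk⟩ := exists_unitSeq_lt hy
  filter_upwards [eventually_le_atBot (k : ℝ)] with t ht
  refine (toUnit_strictMono.monotone ht).trans_lt ?_
  rwa [toUnit, interp_intCast]

theorem eventually_lt_toUnit {y : ℝ} (hy : y < 1) : ∀ᶠ t in atTop, y < toUnit t := by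
  obtain ⟨k, hk⟩ := exists_lt_unitSeq hy
  filter_upwards [eventually_ge_atTop (k : ℝ)] with t ht
  refine lt_of_lt_of_le ?_ (toUnit_strictMono.monotone ht)
  rwa [toUnit, interp_intCast]

theorem lineMap_atBot (f : thompsonF) : ∀ᶠ t in atBot, lineMap f t = t + (phi f).toAdd.1 := by
  obtain ⟨n, v, hv, h⟩ := germ_zero f
  rw [phi_fst_eq hv h]
  filter_upwards [eventually_toUnit_lt (y := v) hv, eventually_lt_atBot 0,
    eventually_lt_atBot (-n : ℝ)] with t h1 h2 h3
  apply toUnit_strictMono.injective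
  rw [toUnit_lineMap, toUnit_add_of_neg h2 (by linarith),
    h _ ⟨(toUnitInterval_pos t).le, h1.le⟩, coe_toUnitInterval]

theorem lineMap_atTop (f : thompsonF) : ∀ᶠ t in atTop, lineMap f t = t - (phi f).toAdd.2 := by
  obtain ⟨n, v, hv, h⟩ := germ_one f
  rw [phi_snd_eq hv h]
  filter_upwards [eventually_lt_toUnit (y := v) hv, eventually_ge_atTop 0,
    eventually_ge_atTop (n : ℝ)] with t h1 h2 h3
  apply toUnit_strictMono.injective
  have h4 := one_sub_toUnit_sub h2 (sub_nonneg.2 h3)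
  have h5 := h (toUnitInterval t) ⟨h1.le, (toUnitInterval_lt_one t).le⟩
  rw [coe_toUnitInterval] at h5
  rw [toUnit_lineMap]
  linarith

/-- An element of `F` is locally dyadic piecewise linear inside the unit interval. The constant
terms of its germs are dyadic because breaks are dyadic and dyadic points map to dyadic points. -/
theorem isDyadicPLAt_toReal (f : thompsonF) {x : ℝ} (h0 : 0 < x) (h1 : x < 1) :
    IsDyadicPLAt (toReal f) x := by
  obtain ⟨f, hf, hpl⟩ := f
  obtain ⟨B, hB, h⟩ := id hpl
  obtain ⟨x, rfl⟩ : ∃ y : unitInterval, (y : ℝ) = x := ⟨⟨x, h0.le, h1.le⟩, rfl⟩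
  have hval : ∀ y : unitInterval, toReal ⟨f, hf, hpl⟩ y = f y := fun y => by
    rw [toReal, projIcc_val]
  obtain ⟨u, hux, hu, hub⟩ := exists_left_break B x h0
  obtain ⟨v, hxv, hv, hvb⟩ := exists_right_break B x h1
  have hud : IsDyadic (u : ℝ) := by
    rcases hu with rfl | hu
    · exact IsDyadic.zero
    · exact hB u hu
  have hvd : IsDyadic (v : ℝ) := by
    rcases hv with rfl | hv
    · simpa using isDyadic_intCast 1
    · exact hB v hv
  have hconst : ∀ (w : unitInterval) (n : ℤ), IsDyadic (w : ℝ) →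
      IsDyadic ((f w : ℝ) + -((2 : ℝ) ^ n * w)) := fun w n hw =>
    ((isDyadic_map_iff hf hpl w).2 hw).add (hw.zpow_mul n).neg
  have lift : ∀ {a b : unitInterval} {y : ℝ}, (a : ℝ) ≤ y → y ≤ b →
      ∃ z : unitInterval, (z : ℝ) = y ∧ a ≤ z ∧ z ≤ b := fun {a b y} ha hb =>
    ⟨⟨y, a.2.1.trans ha, hb.trans b.2.2⟩, rfl, ha, hb⟩
  have hux' : (u : ℝ) < x := hux
  have hxv' : (x : ℝ) < v := hxv
  refine ⟨?_, ?_, fun hx => ?_⟩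
  · obtain ⟨n, hn⟩ := h x v hxv hvb
    refine ⟨n, _, hconst v n hvd, ?_⟩
    filter_upwards [Icc_mem_nhdsGE hxv'] with y hy
    obtain ⟨z, rfl, hz1, hz2⟩ := lift hy.1 hy.2
    rw [hval, hn z ⟨hz1, hz2⟩, hn v ⟨hxv.le, le_rfl⟩]
    ring
  · obtain ⟨n, hn⟩ := h u x hux hub
    refine ⟨n, _, hconst u n hud, ?_⟩
    filter_upwards [Icc_mem_nhdsLE hux'] with y hy
    obtain ⟨z, rfl, hz1, hz2⟩ := lift hy.1 hy.2
    rw [hval, hn z ⟨hz1, hz2⟩]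
    ring
  · have hxB : x ∉ B := fun hxB => hx (hB x hxB)
    obtain ⟨n, hn⟩ := h u v (hux.trans hxv) fun b hb ⟨hb1, hb2⟩ => by
      rcases lt_trichotomy b x with hbx | rfl | hbx
      · exact hub b hb ⟨hb1, hbx⟩
      · exact hxB hb
      · exact hvb b hb ⟨hbx, hb2⟩
    refine ⟨n, _, hconst u n hud, ?_⟩
    filter_upwards [Icc_mem_nhds hux' hxv'] with y hy
    obtain ⟨z, rfl, hz1, hz2⟩ := lift hy.1 hy.2
    rw [hval, hn z ⟨hz1, hz2⟩]
    ring

theorem lineMap_mem_plLine (f : thompsonF) : lineMap f ∈ plLine := by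
  intro t
  -- Divide `toUnit ∘ lineMap f = f ∘ toUnit` on the left by `toUnit`.
  have h : IsDyadicPLAt (toUnit ∘ lineMap f) t := by
    have e : toUnit ∘ lineMap f = toReal f ∘ toUnit := by
      ext t
      rw [Function.comp_apply, toUnit_lineMap, Function.comp_apply, toReal, ← coe_toUnitInterval,
        projIcc_val]
    rw [e]
    exact (isDyadicPLAt_toReal f (toUnit_mem_Ioo t).1 (toUnit_mem_Ioo t).2).comp
      (isDyadicPLAt_toUnit t)
  have h' : IsDyadicPLAt (Function.invFun toUnit) (toUnit (lineMap f t)) := by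
    refine .of_comp ?_ (isDyadicPLAt_toUnit _)
    rw [Function.invFun_comp toUnit_strictMono.injective]
    exact .of_nhds ⟨0, 0, .zero, by simp⟩
  have := h'.comp (g := toUnit ∘ lineMap f) h
  rwa [← Function.comp_assoc, Function.invFun_comp toUnit_strictMono.injective,
    Function.id_comp] at this

theorem lineHom_mem (f : thompsonF) : lineHom f ∈ lineGroup 1 1 := by
  refine ⟨lineMap_mem_plLine f, ⟨(phi f).toAdd.1, ?_⟩, -(phi f).toAdd.2, ?_⟩
  · simpa [lineHom_apply] using lineMap_atBot f
  · simpa [lineHom_apply, sub_eq_add_neg] using lineMap_atTop f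

/-! ### From the line back to the unit interval -/

open Classical in
/-- The extension by the identity of the transport of `g` from the line to `(0, 1)`. -/
noncomputable def unitExt (g : ℝ ≃o ℝ) (x : ℝ) : ℝ :=
  if x ∈ Ioo (0 : ℝ) 1 then toUnit (g (Function.invFun toUnit x)) else x

theorem unitExt_toUnit (g : ℝ ≃o ℝ) (t : ℝ) : unitExt g (toUnit t) = toUnit (g t) := by
  rw [unitExt, if_pos (toUnit_mem_Ioo t),
    Function.leftInverse_invFun toUnit_strictMono.injective]

theorem unitExt_of_notMem (g : ℝ ≃o ℝ) {x : ℝ} (hx : x ∉ Ioo (0 : ℝ) 1) : unitExt g x = x :=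
  if_neg hx

theorem unitExt_mem_Ioo (g : ℝ ≃o ℝ) {x : ℝ} (hx : x ∈ Ioo (0 : ℝ) 1) :
    unitExt g x ∈ Ioo (0 : ℝ) 1 := by
  rw [unitExt, if_pos hx]
  exact toUnit_mem_Ioo _

theorem unitExt_mem_Icc (g : ℝ ≃o ℝ) {x : ℝ} (hx : x ∈ Icc (0 : ℝ) 1) :
    unitExt g x ∈ Icc (0 : ℝ) 1 := by
  by_cases h : x ∈ Ioo (0 : ℝ) 1
  · exact Ioo_subset_Icc_self (unitExt_mem_Ioo g h)
  · rwa [unitExt_of_notMem g h]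

theorem unitExt_strictMono (g : ℝ ≃o ℝ) : StrictMono (unitExt g) := by
  intro x y hxy
  by_cases hx : x ∈ Ioo (0 : ℝ) 1
  · by_cases hy : y ∈ Ioo (0 : ℝ) 1
    · obtain ⟨s, rfl⟩ := exists_toUnit_eq hx.1 hx.2
      obtain ⟨t, rfl⟩ := exists_toUnit_eq hy.1 hy.2
      rw [unitExt_toUnit, unitExt_toUnit]
      exact toUnit_strictMono (g.strictMono (toUnit_strictMono.lt_iff_lt.1 hxy))
    · rw [unitExt_of_notMem g hy]
      exact (unitExt_mem_Ioo g hx).2.trans_le (not_lt.1 fun h => hy ⟨hx.1.trans hxy, h⟩)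
  · rw [unitExt_of_notMem g hx]
    by_cases hy : y ∈ Ioo (0 : ℝ) 1
    · exact lt_of_le_of_lt (not_lt.1 fun h => hx ⟨h, hxy.trans hy.2⟩) (unitExt_mem_Ioo g hy).1
    · rwa [unitExt_of_notMem g hy]

theorem unitExt_symm_unitExt (g : ℝ ≃o ℝ) (x : ℝ) : unitExt g.symm (unitExt g x) = x := by
  by_cases hx : x ∈ Ioo (0 : ℝ) 1
  · obtain ⟨s, rfl⟩ := exists_toUnit_eq hx.1 hx.2
    rw [unitExt_toUnit, unitExt_toUnit, g.symm_apply_apply]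
  · rw [unitExt_of_notMem g hx, unitExt_of_notMem _ hx]

theorem unitExt_near_zero {g : ℝ ≃o ℝ} {m : ℤ} (hm : ∀ᶠ t in atBot, g t = t + m) :
    ∃ ε > 0, ∀ x ∈ Ico 0 ε, unitExt g x = 2 ^ m * x := by
  obtain ⟨T, hT⟩ := eventually_atBot.1
    (hm.and ((eventually_lt_atBot 0).and (eventually_lt_atBot (-m : ℝ))))
  refine ⟨toUnit T, (toUnit_mem_Ioo T).1, fun x hx => ?_⟩
  rcases hx.1.eq_or_lt with rfl | h0
  · rw [unitExt_of_notMem g (by simp), mul_zero]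
  obtain ⟨t, rfl⟩ := exists_toUnit_eq h0 (hx.2.trans (toUnit_mem_Ioo T).2)
  obtain ⟨h1, h2, h3⟩ := hT t (toUnit_strictMono.lt_iff_lt.1 hx.2).le
  rw [unitExt_toUnit, h1, toUnit_add_of_neg h2 (by linarith)]

theorem unitExt_near_one {g : ℝ ≃o ℝ} {n : ℤ} (hn : ∀ᶠ t in atTop, g t = t + n) :
    ∃ ε < 1, ∀ x ∈ Ioc ε 1, 1 - unitExt g x = 2 ^ (-n) * (1 - x) := by
  obtain ⟨T, hT⟩ := eventually_atTop.1
    (hn.and ((eventually_ge_atTop 0).and (eventually_ge_atTop (-n : ℝ))))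
  refine ⟨toUnit T, (toUnit_mem_Ioo T).2, fun x hx => ?_⟩
  rcases hx.2.eq_or_lt with rfl | h1
  · rw [unitExt_of_notMem g (by simp), sub_self, mul_zero]
  obtain ⟨t, rfl⟩ := exists_toUnit_eq ((toUnit_mem_Ioo T).1.trans hx.1) h1
  obtain ⟨h1, h2, h3⟩ := hT t (toUnit_strictMono.lt_iff_lt.1 hx.1).le
  rw [unitExt_toUnit, h1, ← one_sub_toUnit_sub h2] <;> push_cast
  · rw [sub_neg_eq_add]
  · linarith

theorem isDyadicPLAt_unitExt {g : ℝ ≃o ℝ} (hg : g ∈ lineGroup 1 1) {x : ℝ}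
    (hx : x ∈ Icc (0 : ℝ) 1) : IsDyadicPLAt (unitExt g) x := by
  obtain ⟨hg, ⟨m, hm⟩, n, hn⟩ := hg
  simp only [Nat.cast_one, one_mul] at hm hn
  rcases hx.1.eq_or_lt with rfl | h0
  · obtain ⟨ε, hε, h⟩ := unitExt_near_zero hm
    refine ⟨⟨m, 0, .zero, ?_⟩, ⟨0, 0, .zero, ?_⟩, fun h => absurd .zero h⟩
    · filter_upwards [Ico_mem_nhdsGE hε] with x hx
      rw [h x hx, add_zero]
    · filter_upwards [self_mem_nhdsWithin] with x hx
      rw [unitExt_of_notMem g fun h => h.1.not_ge hx]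
      simp
  rcases hx.2.eq_or_lt with rfl | h1
  · obtain ⟨ε, hε, h⟩ := unitExt_near_one hn
    have hd : IsDyadic 1 := by simpa using isDyadic_intCast 1
    refine ⟨⟨0, 0, .zero, ?_⟩, ⟨-n, 1 + -(2 ^ (-n)), hd.add (isDyadic_zpow _).neg, ?_⟩,
      fun h => absurd hd h⟩
    · filter_upwards [self_mem_nhdsWithin] with x hx
      rw [unitExt_of_notMem g fun h => h.2.not_ge hx]
      simp
    · filter_upwards [Ioc_mem_nhdsLE hε] with x hx
      linarith [h x hx]
  · obtain ⟨t, rfl⟩ := exists_toUnit_eq h0 h1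
    refine .of_comp ?_ (isDyadicPLAt_toUnit t)
    have : unitExt g ∘ toUnit = toUnit ∘ g := funext (unitExt_toUnit g)
    rw [this]
    exact (isDyadicPLAt_toUnit _).comp (hg t)

/-- `unitExt` as an order isomorphism of the unit interval. -/
noncomputable def unitIso (g : ℝ ≃o ℝ) : unitInterval ≃o unitInterval where
  toFun x := ⟨unitExt g x, unitExt_mem_Icc g x.2⟩
  invFun x := ⟨unitExt g.symm x, unitExt_mem_Icc g.symm x.2⟩
  left_inv x := Subtype.ext (unitExt_symm_unitExt g x)
  right_inv x := Subtype.ext (unitExt_symm_unitExt g.symm x)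
  map_rel_iff' := (unitExt_strictMono g).le_iff_le

theorem coe_unitIso (g : ℝ ≃o ℝ) (x : unitInterval) : (unitIso g x : ℝ) = unitExt g x := rfl

/-- The multiples of a small power of `1/2` serve as the finite set of breaks. -/
theorem isDyadicPL_of_forall {f : unitInterval → unitInterval} {F : ℝ → ℝ}
    (hfF : ∀ x, (f x : ℝ) = F x) (h : ∀ x ∈ Icc (0 : ℝ) 1, IsDyadicPLAt F x) : IsDyadicPL f := by
  classical
  obtain ⟨K, N, hK⟩ := exists_uniform_subdivision isCompact_Icc h
  replace hK := hK K le_rfl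
  have hpow : (0 : ℝ) < 2 ^ K := by positivity
  refine ⟨(Finset.range (2 ^ K + 1)).image fun j : ℕ => projIcc 0 1 zero_le_one ((j : ℝ) / 2 ^ K),
    ?_, ?_⟩
  · intro b hb
    obtain ⟨j, hj, rfl⟩ := Finset.mem_image.1 hb
    have hj' : (j : ℝ) ≤ 2 ^ K := by exact_mod_cast Nat.lt_succ_iff.1 (Finset.mem_range.1 hj)
    rw [projIcc_of_mem zero_le_one (by
      exact ⟨by positivity, (div_le_one hpow).2 hj'⟩ : (j : ℝ) / 2 ^ K ∈ Icc (0 : ℝ) 1)]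
    exact ⟨j, K, by simp⟩
  · intro u v huv hno
    set j := ⌊(u : ℝ) * 2 ^ K⌋₊ with hj
    have hj1 : (j : ℝ) / 2 ^ K ≤ u := by
      rw [div_le_iff₀ hpow]
      exact Nat.floor_le (mul_nonneg u.2.1 hpow.le)
    have hj2 : (u : ℝ) < (j + 1) / 2 ^ K := by
      rw [lt_div_iff₀ hpow]
      exact Nat.lt_floor_add_one _
    have huv' : (u : ℝ) < v := huv
    have hjK : j + 1 ≤ 2 ^ K := by
      have : (j : ℝ) < 2 ^ K := by
        rw [div_le_iff₀ hpow] at hj1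
        nlinarith [v.2.2]
      exact_mod_cast this
    have hv : (v : ℝ) ≤ (j + 1) / 2 ^ K := by
      by_contra! hlt
      have hmem : ((j + 1 : ℕ) : ℝ) / 2 ^ K ∈ Icc (0 : ℝ) 1 :=
        ⟨by positivity, (div_le_one hpow).2 (by exact_mod_cast hjK)⟩
      refine hno _ (Finset.mem_image_of_mem _ (Finset.mem_range.2 (Nat.lt_succ_of_le hjK))) ?_
      rw [projIcc_of_mem zero_le_one hmem]
      push_cast at hmem
      constructor
      · rw [← Subtype.coe_lt_coe]; push_cast; exact hj2
      · rw [← Subtype.coe_lt_coe]; push_cast; exact hlt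
    have hK := hK j u u.2
    simp only [Int.cast_natCast] at hK
    obtain ⟨n, c, -, hn⟩ := hK ⟨hj1, hj2.le⟩
    refine ⟨n, fun x hx => ?_⟩
    have hx1 : (u : ℝ) ≤ x := hx.1
    have hx2 : (x : ℝ) ≤ v := hx.2
    rw [hfF, hfF, hn x ⟨hj1.trans hx1, hx2.trans hv⟩, hn u ⟨hj1, hj2.le⟩]
    ring

theorem exists_lineHom_eq {g : ℝ ≃o ℝ} (hg : g ∈ lineGroup 1 1) : ∃ f, lineHom f = g := by
  refine ⟨⟨(unitIso g).toHomeomorph, (unitIso g).strictMono,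
    isDyadicPL_of_forall (coe_unitIso g) fun x hx => isDyadicPLAt_unitExt hg hx⟩, ?_⟩
  ext t
  apply toUnit_strictMono.injective
  rw [lineHom_apply, toUnit_lineMap]
  exact unitExt_toUnit g t

theorem range_lineHom : lineHom.range = lineGroup 1 1 :=
  le_antisymm (by rintro _ ⟨f, rfl⟩; exact lineHom_mem f) fun _ => exists_lineHom_eq

/-! ### Generators of `F` and its finite quotients -/

theorem phi_eq_of_lineHom {f : thompsonF} {m n : ℤ}
    (hm : ∀ᶠ t in atBot, lineHom f t = t + m) (hn : ∀ᶠ t in atTop, lineHom f t = t + n) :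
    phi f = Multiplicative.ofAdd (m, -n) := by
  obtain ⟨t, h1, h2⟩ := (hm.and (lineMap_atBot f)).exists
  obtain ⟨u, h3, h4⟩ := (hn.and (lineMap_atTop f)).exists
  rw [lineHom_apply, h2] at h1
  rw [lineHom_apply, h4, sub_eq_add_neg] at h3
  have h1' : (phi f).toAdd.1 = m := by exact_mod_cast add_left_cancel h1
  have h3' : -(phi f).toAdd.2 = n := by exact_mod_cast add_left_cancel h3
  exact Multiplicative.toAdd.injective (Prod.ext h1' (by rw [← h3', neg_neg]; rfl))

/-- The element of `F` that becomes translation by `1` on the line. -/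
noncomputable def genShift : thompsonF := (exists_lineHom_eq (shift_mem 1)).choose

theorem lineHom_genShift : lineHom genShift = shift 1 :=
  (exists_lineHom_eq (shift_mem 1)).choose_spec

/-- The element of `F` that becomes the doubling of `[i, i + 1]` on the line. -/
noncomputable def genDouble (i : ℤ) : thompsonF := (exists_lineHom_eq (double_mem i)).choose

theorem lineHom_genDouble (i : ℤ) : lineHom (genDouble i) = double i :=
  (exists_lineHom_eq (double_mem i)).choose_spec

theorem phi_genShift : phi genShift = Multiplicative.ofAdd (1, -1) :=
  phi_eq_of_lineHom (by simp [lineHom_genShift, shift_apply])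
    (by simp [lineHom_genShift, shift_apply])

theorem phi_genDouble (i : ℤ) : phi (genDouble i) = Multiplicative.ofAdd (0, -1) := by
  refine phi_eq_of_lineHom ?_ ?_ <;> rw [lineHom_genDouble]
  · filter_upwards [eventually_le_atBot (i : ℝ)] with t ht
    rw [double_of_le ht]
    simp
  · filter_upwards [eventually_ge_atTop ((i : ℝ) + 1)] with t ht
    rw [double_of_ge ht]
    simp

theorem genShift_mul_genDouble (i : ℤ) :
    genShift * genDouble i = genDouble (i + 1) * genShift := by
  apply lineHom_injective
  simp only [map_mul, lineHom_genShift, lineHom_genDouble, shift_mul_double]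

theorem genDouble_mul_genDouble {i j : ℤ} (h : i < j) :
    genDouble i * genDouble j = genDouble (j + 1) * genDouble i := by
  apply lineHom_injective
  simp only [map_mul, lineHom_genDouble, double_mul_double h]

theorem closure_generators : Subgroup.closure {genShift, genDouble 0} = ⊤ := by
  refine eq_top_iff.2 fun f _ => ?_
  rw [← Subgroup.mem_map_iff_mem lineHom_injective]
  refine lineGroup_le_of_generators ?_ ?_ (lineHom_mem f)
  · exact ⟨_, Subgroup.subset_closure (by simp), lineHom_genShift⟩
  · exact ⟨_, Subgroup.subset_closure (by simp), lineHom_genDouble 0⟩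

theorem phi_surjective : Function.Surjective phi := by
  intro z
  obtain ⟨x, y⟩ := z
  refine ⟨genShift ^ x * genDouble 0 ^ (-x - y), ?_⟩
  rw [map_mul, map_zpow, map_zpow, phi_genShift, phi_genDouble]
  apply Multiplicative.toAdd.injective
  exact Prod.ext (by simp [toAdd_mul, toAdd_zpow]; rfl) (by simp [toAdd_mul, toAdd_zpow]; rfl)

/-- A finite quotient of `F` identifies `genDouble 0` and `genDouble 1`: conjugation by `genShift`
shifts the index of their images, which are therefore periodic in the index, of some period `r > 0`,
so that `genDouble 0 * genDouble r = genDouble (r + 1) * genDouble 0` becomes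
`genDouble 0 * genDouble 0 = genDouble 1 * genDouble 0`. -/
theorem commute_genShift_genDouble {Q : Type*} [Group Q] [Finite Q] (π : thompsonF →* Q) :
    Commute (π genShift) (π (genDouble 0)) := by
  have hstep : ∀ i, π genShift * π (genDouble i) = π (genDouble (i + 1)) * π genShift := fun i => by
    rw [← map_mul, genShift_mul_genDouble, map_mul]
  have hiter : ∀ (r : ℕ) (i : ℤ),
      π genShift ^ r * π (genDouble i) = π (genDouble (i + r)) * π genShift ^ r := by
    intro r
    induction r with
    | zero => simp
    | succ r ih =>
      intro i
      rw [pow_succ', mul_assoc, ih, ← mul_assoc, hstep, mul_assoc, Nat.cast_succ, add_assoc]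
  have hperiod : ∀ i, π (genDouble (i + orderOf (π genShift))) = π (genDouble i) := fun i => by
    simpa [pow_orderOf_eq_one] using (hiter (orderOf (π genShift)) i).symm
  have h := congrArg π (genDouble_mul_genDouble (i := 0) (j := 0 + orderOf (π genShift))
    (by have := orderOf_pos (π genShift); omega))
  rw [map_mul, map_mul, add_right_comm, hperiod, hperiod] at h
  have h01 : π (genDouble 0) = π (genDouble (0 + 1)) := mul_right_cancel h
  rw [Commute, SemiconjBy, hstep, ← h01]

theorem commute_of_finite {Q : Type*} [Group Q] [Finite Q] (π : thompsonF →* Q) (f g : thompsonF) :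
    Commute (π f) (π g) := by
  have hcomm : ∀ x ∈ π '' {genShift, genDouble 0}, ∀ y ∈ π '' {genShift, genDouble 0},
      x * y = y * x := by
    have := commute_genShift_genDouble π
    rintro _ ⟨x, rfl | rfl, rfl⟩ _ ⟨y, rfl | rfl, rfl⟩
    exacts [rfl, this, this.symm, rfl]
  have hmem : ∀ f, π f ∈ Subgroup.closure (π '' {genShift, genDouble 0}) := fun f => by
    rw [← MonoidHom.map_closure, closure_generators]
    exact Subgroup.mem_map_of_mem π (Subgroup.mem_top f)
  have := Subgroup.isMulCommutative_closure hcomm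
  exact setLike_mul_comm (hmem f) (hmem g)

theorem commutator_le_of_finiteIndex (H : Subgroup thompsonF) [H.FiniteIndex] :
    commutator thompsonF ≤ H := by
  refine le_trans ?_ H.normalCore_le
  rw [commutator_def, Subgroup.commutator_le]
  intro f _ g _
  rw [← QuotientGroup.ker_mk' H.normalCore, MonoidHom.mem_ker, map_commutatorElement,
    commutatorElement_eq_one_iff_commute]
  exact commute_of_finite _ f g

/-- Modulo commutators an element is a product of powers of the two generators, whose images under
`phi` are linearly independent. -/
theorem ker_phi_le_commutator : phi.ker ≤ commutator thompsonF := by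
  intro f hf
  have h : Abelianization.of f ∈ Subgroup.closure
      {Abelianization.of genShift, Abelianization.of (genDouble 0)} := by
    rw [← image_pair, ← MonoidHom.map_closure, closure_generators]
    exact Subgroup.mem_map_of_mem _ (Subgroup.mem_top f)
  obtain ⟨m, n, h⟩ := Subgroup.mem_closure_pair.1 h
  have h' := congrArg (Abelianization.lift phi) h
  simp only [map_mul, map_zpow, Abelianization.lift_apply_of, phi_genShift, phi_genDouble,
    MonoidHom.mem_ker.1 hf] at h'
  have h1 := congrArg (fun z => (Multiplicative.toAdd z).1) h'
  have h2 := congrArg (fun z => (Multiplicative.toAdd z).2) h'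
  simp [toAdd_mul, toAdd_zpow] at h1 h2
  subst h1
  rw [← Abelianization.ker_of, MonoidHom.mem_ker, ← h]
  have : n = 0 := by omega
  simp [this]

theorem ker_phi_le (H : Subgroup thompsonF) [H.FiniteIndex] : phi.ker ≤ H :=
  ker_phi_le_commutator.trans (commutator_le_of_finiteIndex H)

/-! ### Rectangular subgroups -/

theorem mem_rectZ {a b : ℕ} {z : Multiplicative (ℤ × ℤ)} :
    z ∈ rectZ a b ↔ (a : ℤ) ∣ z.toAdd.1 ∧ (b : ℤ) ∣ z.toAdd.2 := by
  rw [rectZ, Subgroup.mem_closure_pair]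
  constructor
  · rintro ⟨m, n, rfl⟩
    simp [toAdd_mul, toAdd_zpow]
  · rintro ⟨⟨m, hm⟩, n, hn⟩
    refine ⟨m, n, Multiplicative.toAdd.injective (Prod.ext ?_ ?_)⟩
    · simp [toAdd_mul, toAdd_zpow, hm, mul_comm]
    · simp [toAdd_mul, toAdd_zpow, hn, mul_comm]

theorem map_lineHom_rectF (a b : ℕ) : (rectF a b).map lineHom = lineGroup a b := by
  ext g
  constructor
  · rintro ⟨f, hf, rfl⟩
    obtain ⟨⟨m, hm⟩, n, hn⟩ := mem_rectZ.1 hf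
    refine ⟨(lineHom_mem f).1, ⟨m, ?_⟩, -n, ?_⟩
    · filter_upwards [lineMap_atBot f] with t ht
      rw [lineHom_apply, ht, hm]
    · filter_upwards [lineMap_atTop f] with t ht
      rw [lineHom_apply, ht, hn]
      push_cast
      ring
  · rintro ⟨hg, ⟨m, hm⟩, n, hn⟩
    obtain ⟨f, rfl⟩ := exists_lineHom_eq (g := g)
      ⟨hg, ⟨a * m, by simpa using hm⟩, b * n, by simpa using hn⟩
    refine ⟨f, mem_rectZ.2 ?_, rfl⟩
    rw [phi_eq_of_lineHom hm hn]
    exact ⟨dvd_mul_right _ _, (dvd_neg.2 (dvd_mul_right _ _))⟩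

theorem nonempty_mulEquiv_rectF {a b : ℕ} (ha : 0 < a) (hb : 0 < b) :
    Nonempty (thompsonF ≃* rectF a b) := by
  obtain ⟨e⟩ := nonempty_lineGroup_mulEquiv ha hb
  have e1 := MonoidHom.ofInjective lineHom_injective
  have e2 := (rectF a b).equivMapOfInjective lineHom lineHom_injective
  rw [range_lineHom] at e1
  rw [map_lineHom_rectF] at e2
  exact ⟨(e1.trans e).trans e2.symm⟩

/-! ### Finite index subgroups of `ℤ²` -/

theorem rectZ_le_iff {c d : ℕ} {L : Subgroup (Multiplicative (ℤ × ℤ))} : rectZ c d ≤ L ↔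
    Multiplicative.ofAdd ((c : ℤ), (0 : ℤ)) ∈ L ∧ Multiplicative.ofAdd ((0 : ℤ), (d : ℤ)) ∈ L := by
  rw [rectZ, Subgroup.closure_le, insert_subset_iff, singleton_subset_iff]
  rfl

theorem rectZ_le_rectZ_iff {a b c d : ℕ} : rectZ c d ≤ rectZ a b ↔ a ∣ c ∧ b ∣ d := by
  simp [rectZ_le_iff, mem_rectZ, Int.natCast_dvd_natCast]

theorem finiteIndex_rectZ {a b : ℕ} (ha : 0 < a) (hb : 0 < b) : (rectZ a b).FiniteIndex := by
  have : NeZero a := ⟨ha.ne'⟩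
  have : NeZero b := ⟨hb.ne'⟩
  have h : rectZ a b = (AddMonoidHom.toMultiplicative
      ((Int.castAddHom (ZMod a)).prodMap (Int.castAddHom (ZMod b)))).ker := by
    ext z
    rw [mem_rectZ, MonoidHom.mem_ker, ← ZMod.intCast_zmod_eq_zero_iff_dvd,
      ← ZMod.intCast_zmod_eq_zero_iff_dvd]
    exact (Prod.ext_iff (x := ((z.toAdd.1 : ZMod a), (z.toAdd.2 : ZMod b))) (y := 0)).symm
  have : Finite (Multiplicative (ZMod a × ZMod b)) := inferInstanceAs (Finite (ZMod a × ZMod b))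
  rw [h]
  exact Subgroup.finiteIndex_ker _

theorem exists_mem_iff_dvd {G : Type*} [CommGroup G] (L : Subgroup G) [L.FiniteIndex] (g : G) :
    ∃ a : ℕ, 0 < a ∧ ∀ c : ℤ, g ^ c ∈ L ↔ (a : ℤ) ∣ c := by
  obtain ⟨⟨r, hr⟩, hgen⟩ := IsCyclic.exists_generator (α := L.comap (zpowersHom G g))
  have key : ∀ c : ℤ, g ^ c ∈ L ↔ r.toAdd ∣ c := by
    intro c
    constructor
    · intro hc
      obtain ⟨k, hk⟩ := hgen ⟨Multiplicative.ofAdd c, by simpa using hc⟩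
      refine ⟨k, ?_⟩
      have := congrArg (fun z => (Subtype.val z).toAdd) hk
      simpa [toAdd_zpow, mul_comm] using this.symm
    · rintro ⟨k, rfl⟩
      rw [zpow_mul]
      exact zpow_mem (by simpa using hr) k
  refine ⟨r.toAdd.natAbs, Int.natAbs_pos.2 fun h0 => ?_, fun c => by rw [key, Int.natAbs_dvd]⟩
  have h1 := (key L.index).1 (by simpa using L.pow_index_mem g)
  rw [h0, zero_dvd_iff] at h1
  exact Subgroup.FiniteIndex.index_ne_zero (by exact_mod_cast h1)

/-- If `b` generates the elements of `L` on the second axis, then modulo `rectZ a b` an element of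
`L` is determined by its first coordinate, which ranges over a cyclic group. -/
theorem isCyclic_quotient_rectZ {a b : ℕ} {L : Subgroup (Multiplicative (ℤ × ℤ))}
    (hb : ∀ y : ℤ, Multiplicative.ofAdd ((0 : ℤ), y) ∈ L → (b : ℤ) ∣ y) :
    IsCyclic (L ⧸ (rectZ a b).subgroupOf L) := by
  let p : L →* Multiplicative ℤ :=
    (AddMonoidHom.toMultiplicative (AddMonoidHom.fst ℤ ℤ)).comp L.subtype
  obtain ⟨⟨_, g, rfl⟩, hg⟩ := IsCyclic.exists_generator (α := p.range)
  refine ⟨⟨(g : L ⧸ (rectZ a b).subgroupOf L), fun q => ?_⟩⟩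
  obtain ⟨z, rfl⟩ := QuotientGroup.mk_surjective q
  obtain ⟨k, hk⟩ := hg ⟨p z, z, rfl⟩
  refine ⟨k, ?_⟩
  have hk' : p (g ^ k) = p z := by
    rw [map_zpow]
    exact congrArg Subtype.val hk
  change ((g ^ k : L) : L ⧸ (rectZ a b).subgroupOf L) = z
  rw [QuotientGroup.eq, Subgroup.mem_subgroupOf, mem_rectZ]
  set w := (g ^ k)⁻¹ * z with hw
  have h0 : (w : Multiplicative (ℤ × ℤ)).toAdd.1 = 0 := by
    have : p w = 1 := by rw [hw, map_mul, map_inv, hk', inv_mul_cancel]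
    exact this
  refine ⟨h0 ▸ dvd_zero _, hb _ ?_⟩
  rw [← h0]
  exact w.2

/-! ### Finite index subgroups of `F` -/

theorem comap_map_phi (H : Subgroup thompsonF) [H.FiniteIndex] : (H.map phi).comap phi = H :=
  Subgroup.comap_map_eq_self (ker_phi_le H)

theorem rectF_le_rectF_iff {a b c d : ℕ} : rectF c d ≤ rectF a b ↔ a ∣ c ∧ b ∣ d := by
  rw [rectF, rectF, Subgroup.comap_le_comap_of_surjective phi_surjective, rectZ_le_rectZ_iff]

theorem rectF_le_iff {c d : ℕ} (H : Subgroup thompsonF) [H.FiniteIndex] :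
    rectF c d ≤ H ↔ rectZ c d ≤ H.map phi := by
  conv_lhs => rw [← comap_map_phi H]
  rw [rectF, Subgroup.comap_le_comap_of_surjective phi_surjective]

theorem finiteIndex_map_phi (H : Subgroup thompsonF) [H.FiniteIndex] : (H.map phi).FiniteIndex :=
  ⟨fun h => Subgroup.FiniteIndex.index_ne_zero (H := H)
    (Nat.eq_zero_of_zero_dvd (h ▸ H.index_map_dvd phi_surjective))⟩

theorem bijOn_map_phi : BijOn (fun H : Subgroup thompsonF => H.map phi)
    {H | H.FiniteIndex} {L | L.FiniteIndex} := by
  refine ⟨fun H (hH : H.FiniteIndex) => finiteIndex_map_phi H, ?_, ?_⟩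
  · intro H (hH : H.FiniteIndex) K (hK : K.FiniteIndex) h
    rw [← comap_map_phi H, ← comap_map_phi K]
    exact congrArg (Subgroup.comap phi) h
  · intro L (hL : L.FiniteIndex)
    exact ⟨L.comap phi, ⟨by rw [L.index_comap_of_surjective phi_surjective]; exact hL.index_ne_zero⟩,
      Subgroup.map_comap_eq_self_of_surjective phi_surjective L⟩

theorem exists_isInner (H : Subgroup thompsonF) [H.FiniteIndex] :
    ∃ a b : ℕ, 0 < a ∧ 0 < b ∧ IsInner H (rectF a b) ∧
      ∀ c d : ℕ, 0 < c → 0 < d → rectF c d ≤ H → a ≤ c ∧ b ≤ d := by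
  have := finiteIndex_map_phi H
  obtain ⟨a, ha, hla⟩ := exists_mem_iff_dvd (H.map phi) (Multiplicative.ofAdd ((1 : ℤ), (0 : ℤ)))
  obtain ⟨b, hb, hlb⟩ := exists_mem_iff_dvd (H.map phi) (Multiplicative.ofAdd ((0 : ℤ), (1 : ℤ)))
  have key : ∀ c d : ℕ, rectF c d ≤ H ↔ a ∣ c ∧ b ∣ d := by
    intro c d
    rw [rectF_le_iff, rectZ_le_iff, ← Int.natCast_dvd_natCast, ← Int.natCast_dvd_natCast, ← hla,
      ← hlb, ← ofAdd_zsmul, ← ofAdd_zsmul]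
    simp
  refine ⟨a, b, ha, hb, ⟨⟨⟨a, b, ha, hb, rfl⟩, (key a b).2 ⟨dvd_rfl, dvd_rfl⟩⟩, ?_⟩, ?_⟩
  · rintro _ ⟨⟨c, d, -, -, rfl⟩, hle⟩
    exact rectF_le_rectF_iff.2 ((key c d).1 hle)
  · intro c d hc hd hle
    obtain ⟨h1, h2⟩ := (key c d).1 hle
    exact ⟨Nat.le_of_dvd hc h1, Nat.le_of_dvd hd h2⟩

theorem IsInner.dvd_of_mem {H : Subgroup thompsonF} [H.FiniteIndex] {a b : ℕ} (ha : 0 < a)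
    (h : IsInner H (rectF a b)) (y : ℤ) (hy : Multiplicative.ofAdd ((0 : ℤ), y) ∈ H.map phi) :
    (b : ℤ) ∣ y := by
  rcases eq_or_ne y 0 with rfl | hy0
  · exact dvd_zero _
  have h1 := (rectZ_le_iff.1 ((rectF_le_iff H).1 h.1.2)).1
  have h2 : Multiplicative.ofAdd ((0 : ℤ), (y.natAbs : ℤ)) ∈ H.map phi := by
    rcases abs_choice y with e | e <;> rw [Int.natCast_natAbs, e]
    · exact hy
    · have := inv_mem hy
      rwa [← ofAdd_neg, Prod.neg_mk, neg_zero] at this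
  have h3 : rectF a y.natAbs ≤ rectF a b :=
    h.2 ⟨⟨a, y.natAbs, ha, Int.natAbs_pos.2 hy0, rfl⟩, (rectF_le_iff H).2 (rectZ_le_iff.2 ⟨h1, h2⟩)⟩
  exact Int.natCast_dvd.2 (rectF_le_rectF_iff.1 h3).2

end Thompson

theorem theorem1p4 :
    -- Part (1): taking images under `φ` is a bijection of finite index subgroups.
    Set.BijOn (fun H : Subgroup thompsonF => H.map Thompson.phi)
      {H | H.FiniteIndex} {L | L.FiniteIndex} ∧
    -- Part (2).
    ∀ H : Subgroup thompsonF, H.FiniteIndex →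
      -- `Inner H` exists; it is `K_(a,b)` for the smallest positive `a` and `b` with `K_(a,b) ≤ H`.
      (∃ a b : ℕ, 0 < a ∧ 0 < b ∧ Thompson.IsInner H (Thompson.rectF a b) ∧
        ∀ c d : ℕ, 0 < c → 0 < d → Thompson.rectF c d ≤ H → a ≤ c ∧ b ≤ d) ∧
      ∀ a b : ℕ, 0 < a → 0 < b → Thompson.IsInner H (Thompson.rectF a b) →
        Thompson.rectZ a b ≤ H.map Thompson.phi ∧
        Finite (Thompson.QuotientQ H a b) ∧
        IsCyclic (Thompson.QuotientQ H a b) ∧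
        Nonempty (thompsonF ≃* Thompson.rectF a b) ∧
        ∃ (ι : Thompson.rectF a b →* H)
          (ρ : H →* Thompson.QuotientQ H a b)
          (ι' : Thompson.rectZ a b →* H.map Thompson.phi)
          (ρ' : H.map Thompson.phi →* Thompson.QuotientQ H a b),
          -- `ι` and `ι'` are the inclusions, `ρ'` is the quotient map.
          (∀ k, (ι k : thompsonF) = k) ∧
          (∀ k, (ι' k : Multiplicative (ℤ × ℤ)) = k) ∧
          ρ' = QuotientGroup.mk' _ ∧
          -- The top row is exact.
          Function.Injective ι ∧ ι.range = ρ.ker ∧ Function.Surjective ρ ∧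
          -- The bottom row is exact.
          Function.Injective ι' ∧ ι'.range = ρ'.ker ∧ Function.Surjective ρ' ∧
          -- The two squares commute.
          (Thompson.phi.subgroupMap H).comp ι =
            ι'.comp (Thompson.phiRect a b) ∧
          ρ = ρ'.comp (Thompson.phi.subgroupMap H) := by
  refine ⟨Thompson.bijOn_map_phi, fun H hH => ⟨Thompson.exists_isInner H, ?_⟩⟩
  intro a b ha hb h
  have hle : Thompson.rectZ a b ≤ H.map Thompson.phi := (Thompson.rectF_le_iff H).1 h.1.2
  have hfin := Thompson.finiteIndex_rectZ ha hb
  refine ⟨hle, Subgroup.finite_quotient_of_finiteIndex,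
    Thompson.isCyclic_quotient_rectZ (h.dvd_of_mem ha), Thompson.nonempty_mulEquiv_rectF ha hb,
    Subgroup.inclusion h.1.2, (QuotientGroup.mk' _).comp (Thompson.phi.subgroupMap H),
    Subgroup.inclusion hle, QuotientGroup.mk' _, fun _ => rfl, fun _ => rfl, rfl,
    Subgroup.inclusion_injective _, ?_,
    (QuotientGroup.mk'_surjective _).comp (Thompson.phi.subgroupMap_surjective H),
    Subgroup.inclusion_injective _, ?_, QuotientGroup.mk'_surjective _, rfl, rfl⟩
  · rw [Subgroup.inclusion_range]
    ext x
    rw [MonoidHom.mem_ker, MonoidHom.comp_apply, ← MonoidHom.mem_ker, QuotientGroup.ker_mk']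
    exact Iff.rfl
  · rw [Subgroup.inclusion_range, QuotientGroup.ker_mk']
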